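/- Let $l\ge 1$ and $k\ge 2$ be integers, and let $\mathfrak g=\mathfrak{sl}_{l+1}(\mathbb C)$ be the simple Lie algebra of type $A_l$, with fundamental weights $\omega_1,\dots,\omega_l$ (with respect to the diagonal Cartan subalgebra and the upper triangular Borel subalgebra). For a dominant integral weight $\mu$ let $\pi_\mu\colon\mathfrak g\to\operatorname{End}V_\mu$ be the irreducible $\mathfrak g$-module of highest weight $\mu$. Let $(x_i)$ be a basis of $\mathfrak g$ and $(x_i^*)$ its dual basis with respect to the Killing form, and for dominant integral $\lambda,\nu$ put $$M_{\lambda,\nu}(C)=\sum_i \pi_\lambda(x_i)\otimes\pi_\nu(x_i^*)\in\operatorname{End}(V_\lambda\otimes V_\nu).$$ Then there exists a dominant integral weight $\nu=\sum_{i=1}^l a_i\omega_i$ ($a_i\in\mathbb Z_{\ge 0}$) such that $V_{k\omega_1}\otimes V_\nu$ has two different irreducible components (irreducible submodules $N_1\ne N_2$) on which $M_{k\omega_1,\nu}(C)$ acts by the same scalar if and only if $l\ge 2$. The same equivalence holds if the two components are moreover required to be non-isomorphic as $\mathfrak g$-modules. -/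

import Mathlib

open scoped TensorProduct

attribute [local instance 100] LieRing.ofAssociativeRing

noncomputable section

namespace TypeA

/-- The simple Lie algebra of type `A_l`, that is `𝔰𝔩(l+1, ℂ)`. -/
abbrev sl (l : ℕ) : LieSubalgebra ℂ (Matrix (Fin (l + 1)) (Fin (l + 1)) ℂ) :=
  LieAlgebra.SpecialLinear.sl (Fin (l + 1)) ℂ

/-- The Cartan subalgebra `𝔥` of diagonal matrices of trace zero. -/
def cartan (l : ℕ) : LieSubalgebra ℂ (sl l) where
  carrier := {h | (h : Matrix (Fin (l + 1)) (Fin (l + 1)) ℂ).IsDiag}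
  add_mem' := fun hx hy => hx.add hy
  zero_mem' := Matrix.isDiag_zero
  smul_mem' := fun c _ hx => hx.smul c
  lie_mem' := by
    intro x y hx hy i j hij
    have hx' := Matrix.IsDiag.diagonal_diag hx
    have hy' := Matrix.IsDiag.diagonal_diag hy
    rw [LieAlgebra.SpecialLinear.sl_bracket, ← hx', ← hy', Matrix.diagonal_mul_diagonal,
      Matrix.diagonal_mul_diagonal]
    simp [hij]

/-- The fundamental weight `ω_{i+1} : 𝔥 → ℂ`, `diag(t_1, …, t_{l+1}) ↦ t_1 + ⋯ + t_{i+1}`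
(with `i` counted from `0`), for the simple roots `t_j - t_{j+1}`. -/
def fundamentalWeight (l : ℕ) (i : Fin l) : Module.Dual ℂ (cartan l) where
  toFun h := ∑ j ∈ Finset.univ.filter (fun j : Fin (l + 1) => (j : ℕ) ≤ i),
    ((h : sl l) : Matrix (Fin (l + 1)) (Fin (l + 1)) ℂ) j j
  map_add' x y := by simp [Finset.sum_add_distrib]
  map_smul' c x := by simp [Finset.mul_sum]

/-- The dominant integral weight `a_1 ω_1 + ⋯ + a_l ω_l` with coefficients `a_i ∈ ℕ`.
The set of dominant integral weights is exactly the range of this map. -/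
def dominantWeight (l : ℕ) (a : Fin l → ℕ) : Module.Dual ℂ (cartan l) :=
  ∑ i, a i • fundamentalWeight l i

/-- The coefficients of `k ω_1`. -/
def kOmegaOne (l k : ℕ) : Fin l → ℕ := fun i => if (i : ℕ) = 0 then k else 0

/-- The universal enveloping algebra of `𝔰𝔩(l+1, ℂ)`. -/
abbrev U (l : ℕ) : Type := UniversalEnvelopingAlgebra ℂ (sl l)

/-- The left ideal of `U(𝔤)` generated by the strictly upper triangular matrices and by the
elements `h - χ(h)`, `h ∈ 𝔥`; the quotient of `U(𝔤)` by it is the Verma module of highest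
weight `χ`. (For a noncommutative ring, `Ideal` means left ideal.) -/
def vermaIdeal (l : ℕ) (χ : Module.Dual ℂ (cartan l)) : Ideal (U l) :=
  Ideal.span
    ({u | ∃ x : sl l, (∀ i j : Fin (l + 1), j ≤ i →
          (x : Matrix (Fin (l + 1)) (Fin (l + 1)) ℂ) i j = 0) ∧
        u = UniversalEnvelopingAlgebra.ι ℂ x} ∪
      {u | ∃ h : cartan l,
        u = UniversalEnvelopingAlgebra.ι ℂ (h : sl l) - algebraMap ℂ (U l) (χ h)})

/-- The sum of all proper left ideals of `U(𝔤)` that contain `vermaIdeal l χ`. It corresponds to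
the largest proper submodule of the Verma module of highest weight `χ`. -/
def maximalIdeal (l : ℕ) (χ : Module.Dual ℂ (cartan l)) : Ideal (U l) :=
  sSup {J | vermaIdeal l χ ≤ J ∧ J ≠ ⊤}

/-- The irreducible `𝔰𝔩(l+1, ℂ)`-module `V_χ` of highest weight `χ`: the quotient of the Verma
module of highest weight `χ` by its largest proper submodule. -/
def V (l : ℕ) (χ : Module.Dual ℂ (cartan l)) : Type := U l ⧸ maximalIdeal l χ

variable {l : ℕ} {χ : Module.Dual ℂ (cartan l)}

instance : AddCommGroup (V l χ) := inferInstanceAs (AddCommGroup (U l ⧸ maximalIdeal l χ))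

instance : Module (U l) (V l χ) := inferInstanceAs (Module (U l) (U l ⧸ maximalIdeal l χ))

instance : Module ℂ (V l χ) := inferInstanceAs (Module ℂ (U l ⧸ maximalIdeal l χ))

instance : IsScalarTower ℂ (U l) (V l χ) :=
  inferInstanceAs (IsScalarTower ℂ (U l) (U l ⧸ maximalIdeal l χ))

instance : LieRingModule (sl l) (V l χ) where
  bracket x v := UniversalEnvelopingAlgebra.ι ℂ x • v
  add_lie x y v := by
    change UniversalEnvelopingAlgebra.ι ℂ (x + y) • v = _
    rw [map_add, add_smul]
  lie_add x v w := smul_add (UniversalEnvelopingAlgebra.ι ℂ x) v w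
  leibniz_lie x y v := by
    change UniversalEnvelopingAlgebra.ι ℂ x • UniversalEnvelopingAlgebra.ι ℂ y • v =
      UniversalEnvelopingAlgebra.ι ℂ ⁅x, y⁆ • v +
        UniversalEnvelopingAlgebra.ι ℂ y • UniversalEnvelopingAlgebra.ι ℂ x • v
    rw [LieHom.map_lie, LieRing.of_associative_ring_bracket, sub_smul, mul_smul, mul_smul,
      sub_add_cancel]

instance : LieModule ℂ (sl l) (V l χ) where
  smul_lie c x v := by
    change UniversalEnvelopingAlgebra.ι ℂ (c • x) • v =
      c • UniversalEnvelopingAlgebra.ι ℂ x • v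
    rw [map_smul, smul_assoc]
  lie_smul c x v := by
    change UniversalEnvelopingAlgebra.ι ℂ x • c • v =
      c • UniversalEnvelopingAlgebra.ι ℂ x • v
    rw [← algebraMap_smul (U l) c v, ← algebraMap_smul (U l) c
      (UniversalEnvelopingAlgebra.ι ℂ x • v), ← mul_smul, ← mul_smul, Algebra.commutes]

/-- `xs` is the dual basis of the basis `x` of `𝔰𝔩(l+1, ℂ)` with respect to the Killing form. -/
def IsKillingDual {l : ℕ} {ι : Type*} [DecidableEq ι] (x : Module.Basis ι ℂ (sl l))
    (xs : ι → sl l) : Prop :=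
  ∀ i j, killingForm ℂ (sl l) (x i) (xs j) = if i = j then 1 else 0

/-- The operator `M_{λ,ν}(C) = ∑ i, π_λ(x_i) ⊗ π_ν(x_i^*)` on `V_λ ⊗ V_ν`. -/
def casimirM {l : ℕ} {ι : Type*} [Fintype ι] (x xs : ι → sl l)
    (lam ν : Module.Dual ℂ (cartan l)) : Module.End ℂ (V l lam ⊗[ℂ] V l ν) :=
  ∑ i, TensorProduct.map (LieModule.toEnd ℂ (sl l) (V l lam) (x i))
    (LieModule.toEnd ℂ (sl l) (V l ν) (xs i))

/-- `N` is an irreducible component of `T`, and the operator `M` acts on it as the scalar `c`. -/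
def IsComponentWithEigenvalue {l : ℕ} {T : Type*} [AddCommGroup T] [Module ℂ T]
    [LieRingModule (sl l) T] [LieModule ℂ (sl l) T] (M : Module.End ℂ T)
    (N : LieSubmodule ℂ (sl l) T) (c : ℂ) : Prop :=
  LieModule.IsIrreducible ℂ (sl l) N ∧ ∀ t ∈ N, M t = c • t

end TypeA

end

/-! Let `c(η) = (η, η + 2ρ)` be the Casimir scalar for the trace form. The Killing form is `2(l+1)`
times the trace form, so `4(l+1) M` is the Casimir operator of the tensor product minus those of the
two factors. On a component of highest weight `η` the operator `M` is therefore an increasing affine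
function of `c(η)`, and the question is when two components have equal `c`
(`IsKillingDual.casimir_tensor`, `isComponentWithEigenvalue_lieSpan`).

For `l ≥ 2` take `ν = 2ω₁ + (k-1)ω₂` and `μ = kω₁ + ν`. Subtracting a simple root `α` from `θ`
changes `c` by `-2⟨θ, α^∨⟩`, and `μ - α₁` pairs to `k` with both `α₁^∨` and `α₂^∨`; hence `μ - 2α₁`
and `μ - α₁ - α₂` have equal `c`. Explicit singular vectors of these weights generate the two
components (`exists_isHW_lower_twice`, `exists_isHW_lower_adjacent`), and these are non-isomorphic
because their highest weights differ.

For `l = 1` the scalar is `n(n+2)/2` at highest weight `n`, which is injective on natural numbers,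
and singular vectors of a given weight in the tensor product are unique up to scalar
(`IsHW.exists_smul_of_tensor`). So the scalar determines the component.

Complete reducibility and the PBW theorem are not needed. A finite-dimensional highest weight module
is irreducible by a Casimir comparison (`IsHW.eq_of_mem_lieSpan`). The quotient `V` is nonzero and
finite-dimensional as soon as its weight is realised by a singular vector of some finite-dimensional
module (`IsFiniteWeight`); the natural module, its tensor square and tensor products supply enough
such weights. -/

noncomputable section

namespace TypeA

/-! ### Matrix units modulo scalars. -/

variable {l : ℕ}

/-- The traceless part of a square matrix, as an element of `𝔰𝔩`. -/
def traceless (l : ℕ) : Matrix (Fin (l + 1)) (Fin (l + 1)) ℂ →ₗ[ℂ] sl l where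
  toFun X := ⟨X - (X.trace / (l + 1)) • 1, by
    have : ((l : ℂ) + 1) ≠ 0 := by exact_mod_cast l.succ_ne_zero
    change Matrix.trace (X - (X.trace / (l + 1)) • (1 : Matrix (Fin (l + 1)) (Fin (l + 1)) ℂ)) = 0
    simp [Matrix.trace_sub, Matrix.trace_smul, this]⟩
  map_add' X Y := by
    ext1
    simp [Matrix.trace_add, add_div, add_smul]
    abel
  map_smul' c X := by
    ext1
    simp [Matrix.trace_smul, smul_sub, mul_div_assoc, mul_smul]

@[simp]
theorem coe_traceless (X : Matrix (Fin (l + 1)) (Fin (l + 1)) ℂ) :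
    (traceless l X : Matrix (Fin (l + 1)) (Fin (l + 1)) ℂ) = X - (X.trace / (l + 1)) • 1 := rfl

theorem traceless_coe (x : sl l) :
    traceless l (x : Matrix (Fin (l + 1)) (Fin (l + 1)) ℂ) = x := by
  ext1
  have : Matrix.trace (x : Matrix (Fin (l + 1)) (Fin (l + 1)) ℂ) = 0 := x.2
  simp [this]

/-- The traceless part of the matrix unit at `(a, b)`. -/
def E (a b : Fin (l + 1)) : sl l := traceless l (Matrix.single a b 1)

theorem coe_E_of_ne {a b : Fin (l + 1)} (h : a ≠ b) :
    (E a b : Matrix (Fin (l + 1)) (Fin (l + 1)) ℂ) = Matrix.single a b 1 := by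
  simp [E, Matrix.trace_single_eq_of_ne a b _ h]

/-- Scalar corrections are central and commutators are traceless. Consequently the `E a b` obey the
matrix unit relations, diagonal ones included, at the price of the single linear relation `∑ E a a =
0`. -/
theorem traceless_lie (X Y : Matrix (Fin (l + 1)) (Fin (l + 1)) ℂ) :
    ⁅traceless l X, traceless l Y⁆ = traceless l (X * Y - Y * X) := by
  ext1
  rw [LieAlgebra.SpecialLinear.sl_bracket]
  simp only [coe_traceless, Matrix.trace_sub, Matrix.trace_mul_comm X Y, sub_mul, mul_sub,
    Matrix.smul_mul, Matrix.mul_smul, mul_one, one_mul, smul_smul, sub_self, zero_div, zero_smul,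
    sub_zero, mul_comm (Y.trace / _)]
  abel

theorem lie_E (a b c d : Fin (l + 1)) :
    ⁅E a b, E c d⁆ = (if b = c then E a d else 0) - (if d = a then E c b else 0) := by
  rw [E, E, traceless_lie, map_sub]
  congr 1
  · split_ifs with h
    · subst h; simp [E]
    · simp [h]
  · split_ifs with h
    · subst h; simp [E]
    · simp [h]

theorem traceless_eq_sum (X : Matrix (Fin (l + 1)) (Fin (l + 1)) ℂ) :
    traceless l X = ∑ a, ∑ b, X a b • E a b := by
  conv_lhs => rw [Matrix.matrix_eq_sum_single X]
  simp only [map_sum, E, ← map_smul, Matrix.smul_single, smul_eq_mul, mul_one]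

theorem eq_sum_E (x : sl l) :
    x = ∑ a, ∑ b, (x : Matrix (Fin (l + 1)) (Fin (l + 1)) ℂ) a b • E a b := by
  rw [← traceless_eq_sum, traceless_coe]

theorem E_diag_mem_cartan (a : Fin (l + 1)) : E a a ∈ cartan l := by
  intro i j hij
  by_cases h : a = i
  · subst h; simp [E, hij]
  · simp [E, hij, h]

/-! ### Singular vectors and the weights below them. -/

section Module

variable {M : Type*} [AddCommGroup M] [Module ℂ M] [LieRingModule (sl l) M] [LieModule ℂ (sl l) M]

theorem E_lie_E_lie (a b c d : Fin (l + 1)) (m : M) :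
    ⁅E a b, ⁅E c d, m⁆⁆ = ⁅E c d, ⁅E a b, m⁆⁆ + (if b = c then ⁅E a d, m⁆ else 0)
      - (if d = a then ⁅E c b, m⁆ else 0) := by
  rw [leibniz_lie, lie_E, sub_lie, apply_ite (⁅·, m⁆), apply_ite (⁅·, m⁆), zero_lie]
  abel

theorem lie_eq_sum (x : sl l) (m : M) :
    ⁅x, m⁆ = ∑ a, ∑ b, (x : Matrix (Fin (l + 1)) (Fin (l + 1)) ℂ) a b • ⁅E a b, m⁆ := by
  conv_lhs => rw [eq_sum_E x]
  simp only [← LieModule.toEnd_apply_apply ℂ, map_sum, LinearMap.sum_apply, map_smul, LinearMap.smul_apply]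

/-- A submodule stable under the elements `E a b` is stable under `𝔰𝔩`. -/
theorem lie_mem_of_E {S : Submodule ℂ M} {m : M} (h : ∀ a b : Fin (l + 1), ⁅E a b, m⁆ ∈ S)
    (x : sl l) : ⁅x, m⁆ ∈ S := by
  rw [lie_eq_sum]
  exact S.sum_mem fun a _ => S.sum_mem fun b _ => S.smul_mem _ (h a b)

/-- `t` is a singular vector of weight `η`: it is killed by the strictly upper triangular matrices
and `E a a` acts on it by `η a`. -/
structure IsHW (η : Fin (l + 1) → ℂ) (t : M) : Prop where
  upper : ∀ a b, a < b → ⁅(E a b : sl l), t⁆ = 0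
  diag : ∀ a, ⁅(E a a : sl l), t⁆ = η a • t

/-- The action of the diagonal element `∑ a, s a • E a a`. -/
def diagEnd (M : Type*) [AddCommGroup M] [Module ℂ M] [LieRingModule (sl l) M]
    [LieModule ℂ (sl l) M] (s : Fin (l + 1) → ℂ) : Module.End ℂ M :=
  ∑ a, s a • LieModule.toEnd ℂ (sl l) M (E a a)

theorem diagEnd_apply (s : Fin (l + 1) → ℂ) (m : M) :
    diagEnd M s m = ∑ a, s a • ⁅(E a a : sl l), m⁆ := by
  simp [diagEnd]

theorem IsHW.diagEnd_eq {η : Fin (l + 1) → ℂ} {t : M} (h : IsHW η t) (s : Fin (l + 1) → ℂ) :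
    diagEnd M s t = (∑ a, s a * η a) • t := by
  simp [diagEnd_apply, h.diag, Finset.sum_smul, smul_smul]

theorem diagEnd_E (s : Fin (l + 1) → ℂ) (c d : Fin (l + 1)) (m : M) :
    diagEnd M s ⁅E c d, m⁆ = ⁅E c d, diagEnd M s m⁆ + (s c - s d) • ⁅E c d, m⁆ := by
  simp only [diagEnd_apply, lie_sum, lie_smul, E_lie_E_lie _ _ c d, smul_add, smul_sub,
    Finset.sum_add_distrib, Finset.sum_sub_distrib, smul_ite, smul_zero, Finset.sum_ite_eq,
    Finset.sum_ite_eq', Finset.mem_univ, if_true, sub_smul]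
  abel

/-- The sum of the eigenspaces of `f` with eigenvalues `μ - r`, `r > 0`. -/
def below (f : Module.End ℂ M) (μ : ℂ) : Submodule ℂ M :=
  ⨆ r : {r : ℝ // 0 < r}, f.eigenspace (μ - (r : ℝ))

theorem disjoint_below (f : Module.End ℂ M) (μ : ℂ) :
    Disjoint (f.eigenspace μ) (below f μ) := by
  refine (f.eigenspaces_iSupIndep μ).mono_right ?_
  refine iSup_le fun r => ?_
  refine le_iSup₂_of_le (μ - (r : ℝ)) ?_ le_rfl
  simp [r.2.ne']

theorem mem_below {f : Module.End ℂ M} {μ : ℂ} {m : M} {r : ℝ} (hr : 0 < r)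
    (h : f m = (μ - r) • m) : m ∈ below f μ :=
  Submodule.mem_iSup_of_mem (⟨r, hr⟩ : {r : ℝ // 0 < r}) (Module.End.mem_eigenspace_iff.2 h)

/-- `s` has strictly decreasing entries, with real differences. -/
def IsDecreasing (s : Fin (l + 1) → ℂ) : Prop :=
  ∀ a b, a < b → ∃ r : ℝ, 0 < r ∧ s a - s b = r

/-- The vectors obtained from `t` by repeatedly applying strictly lower triangular matrix units. -/
inductive Lowered (t : M) : M → Prop
  | base : Lowered t t
  | step (i j : Fin (l + 1)) (hij : j < i) (y : M) (hy : Lowered t y) : Lowered t ⁅E i j, y⁆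

theorem Lowered.lie_mem_span {η : Fin (l + 1) → ℂ} {t y : M} (ht : IsHW η t)
    (hy : Lowered (l := l) t y) (a b : Fin (l + 1)) :
    ⁅E a b, y⁆ ∈ Submodule.span ℂ {z | Lowered (l := l) t z} := by
  induction hy generalizing a b with
  | base =>
    rcases lt_trichotomy a b with h | h | h
    · rw [ht.upper a b h]; exact zero_mem _
    · subst h; rw [ht.diag]
      exact Submodule.smul_mem _ _ (Submodule.subset_span Lowered.base)
    · exact Submodule.subset_span (Lowered.step _ _ h _ .base)
  | step i j hij y hy ih =>
    -- The commutator terms act on the shorter word `y` by other matrix units, which is why the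
    -- induction is generalized over `a` and `b`.
    rw [E_lie_E_lie]
    refine sub_mem (add_mem ?_ ?_) ?_
    · have : Submodule.span ℂ {z | Lowered (l := l) t z} ≤
          (Submodule.span ℂ {z | Lowered (l := l) t z}).comap
            (LieModule.toEnd ℂ (sl l) M (E i j)) :=
        Submodule.span_le.2 fun z hz => Submodule.subset_span (Lowered.step i j hij z hz)
      exact this (ih a b)
    · split_ifs
      exacts [ih _ _, zero_mem _]
    · split_ifs
      exacts [ih _ _, zero_mem _]

theorem IsHW.lieSpan_le {η : Fin (l + 1) → ℂ} {t : M} (ht : IsHW η t) :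
    (LieSubmodule.lieSpan ℂ (sl l) {t}).toSubmodule ≤
      Submodule.span ℂ {z | Lowered (l := l) t z} := by
  let S : LieSubmodule ℂ (sl l) M :=
    { Submodule.span ℂ {z | Lowered (l := l) t z} with
      lie_mem := by
        intro x m hm
        have : Submodule.span ℂ {z | Lowered (l := l) t z} ≤
            (Submodule.span ℂ {z | Lowered (l := l) t z}).comap (LieModule.toEnd ℂ (sl l) M x) :=
          Submodule.span_le.2 fun z hz => lie_mem_of_E (fun a b => hz.lie_mem_span ht a b) x
        exact this hm }
  have : LieSubmodule.lieSpan ℂ (sl l) {t} ≤ S :=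
    LieSubmodule.lieSpan_le.2 (Set.singleton_subset_iff.2 (Submodule.subset_span Lowered.base))
  exact this

/-- Applying `E i j` with `j < i` lowers the eigenvalue by `s j - s i > 0`, so every nonempty word
lies strictly below `t`. -/
theorem Lowered.eq_or_below {η : Fin (l + 1) → ℂ} {t y : M} (ht : IsHW η t)
    (hy : Lowered (l := l) t y) {s : Fin (l + 1) → ℂ} (hs : IsDecreasing s) :
    y = t ∨ ∃ r : ℝ, 0 < r ∧ diagEnd M s y = (∑ a, s a * η a - r) • y := by
  induction hy with
  | base => exact .inl rfl
  | step i j hij y hy ih =>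
    right
    obtain ⟨q, hq, hqs⟩ := hs j i hij
    obtain ⟨r, hr, h⟩ : ∃ r : ℝ, 0 ≤ r ∧ diagEnd M s y = (∑ a, s a * η a - r) • y := by
      rcases ih with rfl | ⟨r, hr, h⟩
      · exact ⟨0, le_rfl, by simp [ht.diagEnd_eq]⟩
      · exact ⟨r, hr.le, h⟩
    refine ⟨r + q, by positivity, ?_⟩
    rw [diagEnd_E, h, lie_smul, ← add_smul]
    congr 1
    push_cast
    rw [← hqs]
    ring

/-- The submodule generated by a singular vector consists of its multiples, up to lower weights. -/
theorem IsHW.exists_of_mem_lieSpan {η : Fin (l + 1) → ℂ} {t y : M} (ht : IsHW η t)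
    {s : Fin (l + 1) → ℂ} (hs : IsDecreasing s) (hy : y ∈ LieSubmodule.lieSpan ℂ (sl l) {t}) :
    ∃ c : ℂ, y - c • t ∈ below (diagEnd M s) (∑ a, s a * η a) := by
  replace hy := ht.lieSpan_le hy
  induction hy using Submodule.span_induction with
  | mem z hz =>
    rcases hz.eq_or_below ht hs with rfl | ⟨r, hr, h⟩
    · exact ⟨1, by simp⟩
    · exact ⟨0, by simpa using mem_below hr h⟩
  | zero => exact ⟨0, by simp⟩
  | add x y _ _ hx hy =>
    obtain ⟨c, hc⟩ := hx
    obtain ⟨d, hd⟩ := hy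
    refine ⟨c + d, ?_⟩
    rw [add_smul, add_sub_add_comm]
    exact add_mem hc hd
  | smul a x _ hx =>
    obtain ⟨c, hc⟩ := hx
    refine ⟨a * c, ?_⟩
    rw [mul_smul, ← smul_sub]
    exact Submodule.smul_mem _ _ hc

/-- In the submodule generated by a singular vector `t`, the weight space of `t` is a line. -/
theorem IsHW.exists_eq_smul {η : Fin (l + 1) → ℂ} {t y : M} (ht : IsHW η t)
    {s : Fin (l + 1) → ℂ} (hs : IsDecreasing s) (hy : y ∈ LieSubmodule.lieSpan ℂ (sl l) {t})
    (h : diagEnd M s y = (∑ a, s a * η a) • y) : ∃ c : ℂ, y = c • t := by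
  obtain ⟨c, hc⟩ := ht.exists_of_mem_lieSpan hs hy
  refine ⟨c, sub_eq_zero.1 ((Submodule.disjoint_def.1 (disjoint_below _ _)) _ ?_ hc)⟩
  rw [Module.End.mem_eigenspace_iff, map_sub, map_smul, ht.diagEnd_eq, h, smul_sub, smul_comm]

end Module

/-! ### The Casimir operator and irreducibility of highest weight modules. -/

section Casimir

variable {M : Type*} [AddCommGroup M] [Module ℂ M] [LieRingModule (sl l) M] [LieModule ℂ (sl l) M]
variable {M' : Type*} [AddCommGroup M'] [Module ℂ M'] [LieRingModule (sl l) M']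
  [LieModule ℂ (sl l) M']

theorem IsHW.map {η : Fin (l + 1) → ℂ} {t : M} (h : IsHW η t) (f : M →ₗ⁅ℂ, sl l⁆ M') :
    IsHW η (f t) where
  upper a b hab := by rw [← LieModuleHom.map_lie, h.upper a b hab, map_zero]
  diag a := by rw [← LieModuleHom.map_lie, h.diag, map_smul]

/-- The Casimir operator of `𝔰𝔩`, normalized by the trace form. -/
def casimir (M : Type*) [AddCommGroup M] [Module ℂ M] [LieRingModule (sl l) M]
    [LieModule ℂ (sl l) M] : Module.End ℂ M :=
  ∑ a, ∑ b, LieModule.toEnd ℂ (sl l) M (E a b) * LieModule.toEnd ℂ (sl l) M (E b a)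

theorem casimir_apply (m : M) :
    casimir (l := l) M m = ∑ a, ∑ b, ⁅(E a b : sl l), ⁅(E b a : sl l), m⁆⁆ := by
  simp [casimir]

/-- Commuting `E c d` through the double sum gives four single sums; the first cancels the fourth
and the second cancels the third. -/
theorem casimir_lie_E (c d : Fin (l + 1)) (m : M) :
    casimir (l := l) M ⁅E c d, m⁆ = ⁅E c d, casimir (l := l) M m⁆ := by
  have key : ∀ a b : Fin (l + 1), ⁅E a b, ⁅E b a, ⁅E c d, m⁆⁆⁆ = ⁅E c d, ⁅E a b, ⁅E b a, m⁆⁆⁆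
      + (if b = c then ⁅E a d, ⁅E b a, m⁆⁆ else 0) - (if d = a then ⁅E c b, ⁅E b a, m⁆⁆ else 0)
      + (if a = c then ⁅E a b, ⁅E b d, m⁆⁆ else 0)
      - (if d = b then ⁅E a b, ⁅E c a, m⁆⁆ else 0) := by
    intro a b
    rw [E_lie_E_lie b a c d, lie_sub, lie_add, E_lie_E_lie a b c d]
    congr 1
    · congr 1
      split_ifs <;> simp
    · split_ifs <;> simp
  simp only [casimir_apply, key, lie_sum, Finset.sum_add_distrib, Finset.sum_sub_distrib]
  have h2 : ∀ f : Fin (l + 1) → Fin (l + 1) → M,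
      ∑ a, ∑ b, (if a = c then f a b else 0) = ∑ b, f c b := by
    intro f
    rw [Finset.sum_comm]
    simp
  have h3 : ∀ f : Fin (l + 1) → Fin (l + 1) → M,
      ∑ a, ∑ b, (if d = a then f a b else 0) = ∑ b, f d b := by
    intro f
    rw [Finset.sum_comm]
    simp
  rw [h2, h3]
  simp

theorem casimir_lie (x : sl l) (m : M) :
    casimir (l := l) M ⁅x, m⁆ = ⁅x, casimir (l := l) M m⁆ := by
  rw [lie_eq_sum x m, lie_eq_sum x]
  simp [casimir_lie_E]

/-- The value of the Casimir operator on a singular vector of weight `η`. -/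
def casimirScalar (η : Fin (l + 1) → ℂ) : ℂ := ∑ a, (η a ^ 2 + (l - 2 * (a : ℕ)) * η a)

/-- This is the pairing with `2ρ`: `η a` occurs with sign `+` for the `l - a` larger indices and
with sign `-` for the `a` smaller ones. -/
theorem sum_lt_sub (η : Fin (l + 1) → ℂ) :
    ∑ a, ∑ b, (if a < b then η a - η b else 0) = ∑ a : Fin (l + 1), (l - 2 * (a : ℕ)) * η a := by
  have h1 : ∑ a, ∑ b, (if a < b then η a - η b else 0) =
      ∑ a : Fin (l + 1), ∑ b, (if a < b then η a else 0)
        - ∑ a : Fin (l + 1), ∑ b, (if b < a then η a else 0) := by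
    rw [Finset.sum_comm (f := fun a b : Fin (l + 1) => if b < a then η a else 0),
      ← Finset.sum_sub_distrib]
    refine Finset.sum_congr rfl fun a _ => ?_
    rw [← Finset.sum_sub_distrib]
    refine Finset.sum_congr rfl fun b _ => ?_
    split_ifs <;> simp
  rw [h1, ← Finset.sum_sub_distrib]
  refine Finset.sum_congr rfl fun a _ => ?_
  have e1 : (Finset.univ.filter fun b : Fin (l + 1) => a < b) = Finset.Ioi a := by ext; simp
  have e2 : (Finset.univ.filter fun b : Fin (l + 1) => b < a) = Finset.Iio a := by ext; simp
  rw [← Finset.sum_filter, ← Finset.sum_filter, Finset.sum_const, Finset.sum_const, e1, e2,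
    Fin.card_Ioi, Fin.card_Iio, nsmul_eq_mul, nsmul_eq_mul, Nat.sub_sub, Nat.add_comm 1,
    Nat.add_sub_add_right, Nat.cast_sub (Nat.lt_succ_iff.1 a.2)]
  ring

theorem IsHW.casimir_eq {η : Fin (l + 1) → ℂ} {t : M} (h : IsHW η t) :
    casimir (l := l) M t = casimirScalar η • t := by
  have key : ∀ a b : Fin (l + 1), ⁅(E a b : sl l), ⁅(E b a : sl l), t⁆⁆ =
      ((if a < b then η a - η b else 0) + if a = b then η a ^ 2 else 0) • t := by
    intro a b
    rcases lt_trichotomy a b with hab | hab | hab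
    · rw [E_lie_E_lie, h.upper a b hab]
      simp [hab, hab.ne, h.diag, sub_smul]
    · subst hab
      simp [h.diag, smul_smul, sq]
    · rw [h.upper b a hab]
      simp [hab.ne', hab.not_gt]
  rw [casimir_apply]
  simp only [key, ← Finset.sum_smul, Finset.sum_add_distrib, sum_lt_sub]
  simp [casimirScalar, Finset.sum_add_distrib, add_comm]

/-- An eigenspace of an operator commuting with the action is a submodule. -/
theorem casimir_eq_of_mem_lieSpan {t y : M} {c : ℂ} (h : casimir (l := l) M t = c • t)
    (hy : y ∈ LieSubmodule.lieSpan ℂ (sl l) {t}) : casimir (l := l) M y = c • y := by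
  let S : LieSubmodule ℂ (sl l) M :=
    { (casimir (l := l) M).eigenspace c with
      lie_mem := by
        intro x m hm
        have hm' : casimir (l := l) M m = c • m := Module.End.mem_eigenspace_iff.1 hm
        refine Module.End.mem_eigenspace_iff.2 ?_
        rw [casimir_lie, hm', lie_smul] }
  have : LieSubmodule.lieSpan ℂ (sl l) {t} ≤ S :=
    LieSubmodule.lieSpan_le.2 (Set.singleton_subset_iff.2 (Module.End.mem_eigenspace_iff.2 h))
  exact Module.End.mem_eigenspace_iff.1 (this hy)

theorem isSl2Triple {a b : Fin (l + 1)} (hab : a ≠ b) :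
    IsSl2Triple (E a a - E b b : sl l) (E a b) (E b a) where
  h_ne_zero := by
    intro h
    have := congrArg (fun x : sl l => (x : Matrix (Fin (l + 1)) (Fin (l + 1)) ℂ) a a) h
    simp [E, hab.symm] at this
  lie_e_f := by simp [lie_E]
  lie_h_e_nsmul := by simp [sub_lie, lie_E, hab.symm, two_smul]
  lie_h_f_nsmul := by simp [sub_lie, lie_E, hab, two_smul]; abel

theorem IsHW.hasPrimitiveVectorWith {η : Fin (l + 1) → ℂ} {t : M} (h : IsHW η t) (ht : t ≠ 0)
    {a b : Fin (l + 1)} (hab : a < b) :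
    (isSl2Triple (l := l) hab.ne).HasPrimitiveVectorWith t (η a - η b) where
  ne_zero := ht
  lie_h := by rw [sub_lie, h.diag, h.diag, sub_smul]
  lie_e := h.upper a b hab

theorem IsHW.exists_nat [FiniteDimensional ℂ M] {η : Fin (l + 1) → ℂ} {t : M} (h : IsHW η t)
    (ht : t ≠ 0) {a b : Fin (l + 1)} (hab : a < b) : ∃ n : ℕ, η a - η b = n :=
  (h.hasPrimitiveVectorWith ht hab).exists_nat

/-- A difference of squares turns the quadratic comparison into a linear one: both sums evaluate the
same functional `η + η' + 2ρ`, at `η` and at `η'`. -/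
theorem casimirScalar_sub (η η' : Fin (l + 1) → ℂ) :
    casimirScalar η - casimirScalar η' =
      ∑ a, (η a + η' a + (l - 2 * (a : ℕ))) * η a - ∑ a, (η a + η' a + (l - 2 * (a : ℕ))) * η' a := by
  rw [casimirScalar, casimirScalar, ← Finset.sum_sub_distrib, ← Finset.sum_sub_distrib]
  exact Finset.sum_congr rfl fun a _ => by ring

/-- Singular vectors in a finite-dimensional highest weight module are multiples of the generator. -/
theorem IsHW.eq_of_mem_lieSpan [FiniteDimensional ℂ M] {η η' : Fin (l + 1) → ℂ} {t w : M}
    (ht : IsHW η t) (hw : IsHW η' w) (hw0 : w ≠ 0)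
    (hwt : w ∈ LieSubmodule.lieSpan ℂ (sl l) {t}) : η' = η ∧ ∃ c : ℂ, w = c • t := by
  have ht0 : t ≠ 0 := by
    rintro rfl
    have hle : LieSubmodule.lieSpan ℂ (sl l) {(0 : M)} ≤ ⊥ := LieSubmodule.lieSpan_le.2 (by simp)
    exact hw0 (by simpa using hle hwt)
  have hc : casimirScalar η' = casimirScalar η :=
    smul_left_injective ℂ hw0 <| by
      simpa only [hw.casimir_eq] using casimir_eq_of_mem_lieSpan ht.casimir_eq hwt
  -- Finite dimension makes `η` and `η'` dominant, and the `2ρ` term makes the sum strictly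
  -- decreasing.
  have hs : IsDecreasing (fun a : Fin (l + 1) => η' a + η a + (l - 2 * ((a : ℕ) : ℂ))) := by
    intro a b hab
    obtain ⟨n, hn⟩ := ht.exists_nat ht0 hab
    obtain ⟨n', hn'⟩ := hw.exists_nat hw0 hab
    have : ((a : ℕ) : ℝ) < (b : ℕ) := by exact_mod_cast hab
    refine ⟨n + n' + 2 * ((b : ℕ) - (a : ℕ)), by have := sub_pos.2 this; positivity, ?_⟩
    push_cast
    linear_combination hn + hn'
  -- Equal Casimir scalars place `w` in the same `diagEnd`-eigenspace as `t`, which is a line in the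
  -- module generated by `t`.
  have h0 := casimirScalar_sub η' η
  rw [hc, sub_self, eq_comm, sub_eq_zero] at h0
  obtain ⟨c, rfl⟩ := ht.exists_eq_smul hs hwt (by rw [hw.diagEnd_eq, h0])
  refine ⟨funext fun a => ?_, c, rfl⟩
  refine smul_left_injective ℂ hw0 ?_
  change η' a • c • t = η a • c • t
  rw [← hw.diag, lie_smul, ht.diag, smul_comm]

/-- Take an eigenvector whose eigenvalue has maximal real part: `E a b` with `a < b` would raise it
by `b - a`. -/
theorem exists_forall_upper_eq_zero [FiniteDimensional ℂ M] [Nontrivial M] :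
    ∃ m : M, m ≠ 0 ∧ ∀ a b, a < b → ⁅(E a b : sl l), m⁆ = 0 := by
  set s : Fin (l + 1) → ℂ := fun a => -((a : ℕ) : ℂ) with hs
  have hfin : {μ | (diagEnd M s).HasEigenvalue μ}.Finite := Module.End.finite_hasEigenvalue _
  obtain ⟨μ, hμ, hmax⟩ := hfin.exists_maximalFor Complex.re _
    (Module.End.exists_eigenvalue (diagEnd M s))
  obtain ⟨m, hm⟩ := Module.End.HasEigenvalue.exists_hasEigenvector hμ
  refine ⟨m, hm.2, fun a b hab => ?_⟩
  by_contra hne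
  have hev : (diagEnd M s).HasEigenvalue (μ + (s a - s b)) := by
    refine Module.End.hasEigenvalue_of_hasEigenvector (x := ⁅E a b, m⁆)
      ⟨Module.End.mem_eigenspace_iff.2 ?_, hne⟩
    rw [diagEnd_E, hm.apply_eq_smul, lie_smul, add_smul]
  have := hmax hev (by simp [hs, hab.le])
  simp [hs, hab.not_ge] at this

/-- A nonzero finite-dimensional module contains a singular vector. -/
theorem exists_isHW [FiniteDimensional ℂ M] [Nontrivial M] :
    ∃ (η : Fin (l + 1) → ℂ) (t : M), t ≠ 0 ∧ IsHW η t := by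
  -- The elements `E a a` are diagonalized one at a time: the vectors that already satisfy the
  -- conditions for `S` form a space stable under the next `E b b`.
  suffices h : ∀ S : Finset (Fin (l + 1)), ∃ (η : Fin (l + 1) → ℂ) (t : M), t ≠ 0 ∧
      (∀ a b, a < b → ⁅(E a b : sl l), t⁆ = 0) ∧ ∀ a ∈ S, ⁅(E a a : sl l), t⁆ = η a • t by
    obtain ⟨η, t, h0, h1, h2⟩ := h Finset.univ
    exact ⟨η, t, h0, h1, fun a => h2 a (Finset.mem_univ a)⟩
  intro S
  induction S using Finset.induction_on with
  | empty =>
    obtain ⟨m, hm, h⟩ := exists_forall_upper_eq_zero (l := l) (M := M)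
    exact ⟨0, m, hm, h, by simp⟩
  | insert b S hb ih =>
    obtain ⟨η, t, h0, h1, h2⟩ := ih
    let K : Submodule ℂ M :=
      { carrier := {m | (∀ a b, a < b → ⁅(E a b : sl l), m⁆ = 0) ∧
          ∀ a ∈ S, ⁅(E a a : sl l), m⁆ = η a • m}
        zero_mem' := by simp
        add_mem' := by
          rintro x y ⟨hx, hx'⟩ ⟨hy, hy'⟩
          exact ⟨fun a b hab => by rw [lie_add, hx a b hab, hy a b hab, add_zero],
            fun a ha => by rw [lie_add, hx' a ha, hy' a ha, smul_add]⟩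
        smul_mem' := by
          rintro c x ⟨hx, hx'⟩
          exact ⟨fun a b hab => by rw [lie_smul, hx a b hab, smul_zero],
            fun a ha => by rw [lie_smul, hx' a ha, smul_comm]⟩ }
    have hK : ∀ m ∈ K, LieModule.toEnd ℂ (sl l) M (E b b) m ∈ K := by
      rintro m ⟨hm, hm'⟩
      refine ⟨fun c d hcd => ?_, fun c hc => ?_⟩
      · rw [LieModule.toEnd_apply_apply, E_lie_E_lie, hm c d hcd]
        have h3 : (if d = b then ⁅(E c b : sl l), m⁆ else 0) = 0 := by
          split_ifs with h
          · subst h; exact hm _ _ hcd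
          · rfl
        have h4 : (if b = c then ⁅(E b d : sl l), m⁆ else 0) = 0 := by
          split_ifs with h
          · subst h; exact hm _ _ hcd
          · rfl
        rw [h3, h4]
        simp
      · rw [LieModule.toEnd_apply_apply, E_lie_E_lie, hm' c hc, lie_smul, add_sub_assoc]
        convert add_zero _
        by_cases h : c = b
        · subst h; simp
        · simp [h, Ne.symm h]
    have : Nontrivial K := ⟨⟨⟨t, h1, h2⟩, 0, fun h => h0 (congrArg Subtype.val h)⟩⟩
    obtain ⟨μ, hμ⟩ := Module.End.exists_eigenvalue
      ((LieModule.toEnd ℂ (sl l) M (E b b)).restrict hK)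
    obtain ⟨m, hm⟩ := Module.End.HasEigenvalue.exists_hasEigenvector hμ
    refine ⟨Function.update η b μ, m, fun h => hm.2 (Subtype.ext h), m.2.1, fun a ha => ?_⟩
    rcases Finset.mem_insert.1 ha with rfl | ha'
    · simpa using congrArg Subtype.val hm.apply_eq_smul
    · rw [Function.update_of_ne (show a ≠ b from fun h => hb (h ▸ ha'))]
      exact m.2.2 a ha'

/-- A submodule contains a singular vector of the ambient module, unless it is zero. -/
theorem exists_isHW_mem [FiniteDimensional ℂ M] {N : LieSubmodule ℂ (sl l) M} (hN : N ≠ ⊥) :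
    ∃ (η : Fin (l + 1) → ℂ) (t : M), t ∈ N ∧ t ≠ 0 ∧ IsHW η t := by
  have : Nontrivial N := (LieSubmodule.nontrivial_iff_ne_bot ℂ (sl l) M).2 hN
  have : FiniteDimensional ℂ N := inferInstanceAs (FiniteDimensional ℂ N.toSubmodule)
  obtain ⟨η, t, ht, h⟩ := exists_isHW (l := l) (M := N)
  exact ⟨η, t, t.2, fun h0 => ht (Subtype.ext h0), h.map N.incl⟩

/-- A finite-dimensional highest weight module is irreducible. -/
theorem IsHW.isIrreducible [FiniteDimensional ℂ M] {η : Fin (l + 1) → ℂ} {t : M}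
    (ht : IsHW η t) (ht0 : t ≠ 0) :
    LieModule.IsIrreducible ℂ (sl l) (LieSubmodule.lieSpan ℂ (sl l) {t}) := by
  set N := LieSubmodule.lieSpan ℂ (sl l) {t} with hN
  have htN : t ∈ N := LieSubmodule.subset_lieSpan rfl
  have : Nontrivial N := ⟨⟨⟨t, htN⟩, 0, fun h => ht0 (congrArg Subtype.val h)⟩⟩
  have : FiniteDimensional ℂ N := inferInstanceAs (FiniteDimensional ℂ N.toSubmodule)
  refine LieModule.IsIrreducible.mk fun N' hN' => ?_
  -- A nonzero submodule contains a singular vector, necessarily a multiple of `t`, hence contains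
  -- the generator.
  obtain ⟨η', w, hw, hw0, hw'⟩ := exists_isHW_mem hN'
  have hw0' : (w : M) ≠ 0 := fun h0 => hw0 (Subtype.ext h0)
  obtain ⟨-, c, hc⟩ := ht.eq_of_mem_lieSpan (hw'.map N.incl) hw0' w.2
  have hc0 : c ≠ 0 := by
    rintro rfl
    exact hw0' (by simpa using hc)
  have htN' : (⟨t, htN⟩ : N) ∈ N' := by
    have : (⟨t, htN⟩ : N) = c⁻¹ • w := by
      ext1
      change t = c⁻¹ • (w : M)
      rw [show (w : M) = c • t from hc, inv_smul_smul₀ hc0]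
    rw [this]
    exact N'.smul_mem _ hw
  have hle : N ≤ N'.map N.incl :=
    LieSubmodule.lieSpan_le.2 (Set.singleton_subset_iff.2
      ((LieSubmodule.mem_map _).2 ⟨⟨t, htN⟩, htN', rfl⟩))
  rw [eq_top_iff]
  rintro ⟨y, hy⟩ -
  obtain ⟨z, hz, hzy⟩ := (LieSubmodule.mem_map _).1 (hle hy)
  have : z = ⟨y, hy⟩ := Subtype.ext hzy
  exact this ▸ hz

/-- Singular vectors of different weights generate non-isomorphic submodules. -/
theorem IsHW.not_nonempty_equiv [FiniteDimensional ℂ M] {η η' : Fin (l + 1) → ℂ} {t t' : M}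
    (ht : IsHW η t) (ht0 : t ≠ 0) (ht' : IsHW η' t') (hne : η ≠ η') :
    ¬ Nonempty (LieSubmodule.lieSpan ℂ (sl l) {t} ≃ₗ⁅ℂ, sl l⁆
      LieSubmodule.lieSpan ℂ (sl l) {t'}) := by
  rintro ⟨φ⟩
  set N := LieSubmodule.lieSpan ℂ (sl l) {t}
  set N' := LieSubmodule.lieSpan ℂ (sl l) {t'}
  have htN : t ∈ N := LieSubmodule.subset_lieSpan rfl
  have h1 : IsHW η (⟨t, htN⟩ : N) :=
    ⟨fun a b hab => Subtype.ext (ht.upper a b hab), fun a => Subtype.ext (ht.diag a)⟩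
  have h2 := (h1.map φ.toLieModuleHom).map N'.incl
  refine hne (ht'.eq_of_mem_lieSpan h2 ?_ (φ ⟨t, htN⟩).2).1
  intro h0
  have h3 : φ ⟨t, htN⟩ = 0 := Subtype.ext h0
  have h4 : (⟨t, htN⟩ : N) = 0 := φ.injective (h3.trans (map_zero φ.toLieModuleHom).symm)
  exact ht0 (congrArg Subtype.val h4)

end Casimir

/-! ### The Killing form, dual bases and the Casimir operator on tensor products. -/

section Killing

/-- The trace is taken on all matrices, where the matrix units form a basis and the diagonal
coefficients can be read off. -/
theorem trace_commutator_comp {n : Type*} [Fintype n] [DecidableEq n] (A B : Matrix n n ℂ) :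
    LinearMap.trace ℂ (Matrix n n ℂ)
      ((LinearMap.mulLeft ℂ A - LinearMap.mulRight ℂ A) ∘ₗ
        (LinearMap.mulLeft ℂ B - LinearMap.mulRight ℂ B)) =
      2 * Fintype.card n * (A * B).trace - 2 * (A.trace * B.trace) := by
  rw [LinearMap.trace_eq_matrix_trace ℂ (Matrix.stdBasis ℂ n n), Matrix.trace,
    Fintype.sum_prod_type]
  have key : ∀ i j : n, Matrix.diag (LinearMap.toMatrix (Matrix.stdBasis ℂ n n)
      (Matrix.stdBasis ℂ n n) ((LinearMap.mulLeft ℂ A - LinearMap.mulRight ℂ A) ∘ₗ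
        (LinearMap.mulLeft ℂ B - LinearMap.mulRight ℂ B))) (i, j) =
      (A * B) i i - A i i * B j j - (B i i * A j j - (B * A) j j) := by
    intro i j
    rw [Matrix.diag_apply, LinearMap.toMatrix_apply, Matrix.stdBasis_eq_single]
    change (A * (B * Matrix.single i j 1 - Matrix.single i j 1 * B) -
      (B * Matrix.single i j 1 - Matrix.single i j 1 * B) * A : Matrix n n ℂ) i j = _
    have h : ∀ M N : Matrix n n ℂ, (M * Matrix.single i j 1 * N : Matrix n n ℂ) i j = M i i * N j j := by
      intro M N
      rw [Matrix.mul_assoc, Matrix.mul_apply,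
        Finset.sum_eq_single i (fun b _ hb => by simp [hb]) (by simp)]
      simp
    have h1 := h (A * B) 1
    have h2 := h A B
    have h3 := h B A
    have h4 := h 1 (B * A)
    simp only [mul_one, one_mul, Matrix.one_apply_eq] at h1 h4
    simp only [mul_sub, sub_mul, Matrix.sub_apply, ← mul_assoc] at *
    rw [h1, h2, h3, h4]
  simp only [key, Finset.sum_sub_distrib, Finset.sum_const, ← Finset.sum_mul, ← Finset.mul_sum,
    nsmul_eq_mul, Finset.card_univ]
  have h1 : ∑ i, (A * B) i i = (A * B).trace := rfl
  have h2 : ∑ i, (B * A) i i = (A * B).trace := Matrix.trace_mul_comm B A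
  have h3 : ∑ i, A i i = A.trace := rfl
  have h4 : ∑ i, B i i = B.trace := rfl
  simp only [h1, h2, h3, h4]
  ring

/-- The Killing form of `𝔰𝔩` is a multiple of the trace form. -/
theorem killingForm_eq_trace (x y : sl l) :
    killingForm ℂ (sl l) x y = 2 * (l + 1) *
      ((x : Matrix (Fin (l + 1)) (Fin (l + 1)) ℂ) * (y : Matrix _ _ ℂ)).trace := by
  set A : Matrix (Fin (l + 1)) (Fin (l + 1)) ℂ := x.1 with hA
  set B : Matrix (Fin (l + 1)) (Fin (l + 1)) ℂ := y.1 with hB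
  have hAt : A.trace = 0 := x.2
  -- The composite maps every matrix to a commutator, so its trace on all matrices equals its trace
  -- on `sl l`.
  have hmem : ∀ X, ((LinearMap.mulLeft ℂ A - LinearMap.mulRight ℂ A) ∘ₗ
      (LinearMap.mulLeft ℂ B - LinearMap.mulRight ℂ B)) X ∈ (sl l).toSubmodule := by
    intro X
    change Matrix.trace (A * (B * X - X * B) - (B * X - X * B) * A) = 0
    rw [Matrix.trace_sub, Matrix.trace_mul_comm, sub_self]
  have h := LinearMap.trace_restrict_eq_of_forall_mem (sl l).toSubmodule _ hmem
  rw [trace_commutator_comp, hAt] at h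
  rw [killingForm_apply_apply]
  simp only [Fintype.card_fin, Nat.cast_add, Nat.cast_one, zero_mul, mul_zero, sub_zero] at h
  rw [← h]
  rfl

theorem trace_E_mul (a b : Fin (l + 1)) (y : sl l) :
    ((E a b : Matrix (Fin (l + 1)) (Fin (l + 1)) ℂ) * (y : Matrix _ _ ℂ)).trace =
      (y : Matrix (Fin (l + 1)) (Fin (l + 1)) ℂ) b a := by
  have hy : Matrix.trace (y : Matrix (Fin (l + 1)) (Fin (l + 1)) ℂ) = 0 := y.2
  simp [E, sub_mul, Matrix.trace_sub, Matrix.trace_smul, hy, Matrix.trace_single_mul]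

variable {ι : Type*} [Fintype ι] [DecidableEq ι] {x : Module.Basis ι ℂ (sl l)} {xs : ι → sl l}

theorem IsKillingDual.sum_eq (hx : IsKillingDual x xs) (y : sl l) :
    y = ∑ i, killingForm ℂ (sl l) y (xs i) • x i := by
  have h : ∀ i, killingForm ℂ (sl l) y (xs i) = x.repr y i := by
    intro i
    conv_lhs => rw [← x.sum_repr y]
    simp only [map_sum, map_smul, LinearMap.sum_apply, LinearMap.smul_apply, hx _ i]
    simp
  simp only [h, x.sum_repr]

/-- The canonical tensor of the Killing form, in terms of matrix units. -/
theorem IsKillingDual.sum_bilin (hx : IsKillingDual x xs) {Z : Type*} [AddCommGroup Z] [Module ℂ Z]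
    (β : sl l →ₗ[ℂ] sl l →ₗ[ℂ] Z) :
    ∑ a, ∑ b, β (E a b) (E b a) = (2 * (l + 1) : ℂ) • ∑ i, β (x i) (xs i) := by
  -- The coefficient of `E a b` at `x i` is its Killing pairing with `xs i`, which is `2(l+1)` times
  -- the `(b, a)` entry of `xs i`.
  have h1 : ∀ a b : Fin (l + 1), β (E a b) (E b a) =
      ∑ i, (2 * (l + 1) : ℂ) • (xs i : Matrix (Fin (l + 1)) (Fin (l + 1)) ℂ) b a •
        β (x i) (E b a) := by
    intro a b
    conv_lhs => rw [hx.sum_eq (E a b)]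
    simp [killingForm_eq_trace, trace_E_mul, mul_smul]
  have h2 : ∀ i, β (x i) (xs i) =
      ∑ a, ∑ b, (xs i : Matrix (Fin (l + 1)) (Fin (l + 1)) ℂ) b a • β (x i) (E b a) := by
    intro i
    conv_lhs => rw [eq_sum_E (xs i)]
    rw [Finset.sum_comm]
    simp
  simp only [h1, h2, Finset.smul_sum]
  rw [Finset.sum_comm]
  refine Eq.trans ?_ Finset.sum_comm
  rw [Finset.sum_comm]
  refine Finset.sum_congr rfl fun a _ => ?_
  rw [Finset.sum_comm]

variable (M M' : Type*) [AddCommGroup M] [Module ℂ M] [LieRingModule (sl l) M]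
  [LieModule ℂ (sl l) M] [AddCommGroup M'] [Module ℂ M'] [LieRingModule (sl l) M']
  [LieModule ℂ (sl l) M']

/-- The Leibniz rule yields two mixed sums, equal after exchanging `a` and `b`. Each is `2(l+1)`
times the Killing sum, whence the factor `4(l+1)`. -/
theorem IsKillingDual.casimir_tensor (hx : IsKillingDual x xs) :
    casimir (l := l) (M ⊗[ℂ] M') =
      (casimir (l := l) M).rTensor M' + (casimir (l := l) M').lTensor M +
        (4 * (l + 1) : ℂ) • ∑ i, TensorProduct.map (LieModule.toEnd ℂ (sl l) M (x i))
          (LieModule.toEnd ℂ (sl l) M' (xs i)) := by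
  have h := hx.sum_bilin (((TensorProduct.mapBilinear (RingHom.id ℂ) M M' M M').compl₁₂
    (LieModule.toEnd ℂ (sl l) M).toLinearMap (LieModule.toEnd ℂ (sl l) M').toLinearMap))
  simp only [LinearMap.compl₁₂_apply, LieHom.coe_toLinearMap, TensorProduct.mapBilinear_apply] at h
  rw [show (4 * (l + 1) : ℂ) = 2 * (2 * (l + 1)) by ring, mul_smul, ← h, two_smul]
  ext m m'
  have h2 : ∑ a, ∑ b, ⁅(E a b : sl l), m⁆ ⊗ₜ[ℂ] ⁅(E b a : sl l), m'⁆ =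
      ∑ a, ∑ b, ⁅(E b a : sl l), m⁆ ⊗ₜ[ℂ] ⁅(E a b : sl l), m'⁆ := Finset.sum_comm
  simp [casimir_apply, Finset.sum_add_distrib, TensorProduct.sum_tmul, TensorProduct.tmul_sum, h2]
  abel

end Killing

/-! ### Quotients of the enveloping algebra; nonvanishing and finite dimension of `V`. -/

section HighestWeightModule

theorem U_induction {p : U l → Prop} (h_algebraMap : ∀ c, p (algebraMap ℂ (U l) c))
    (h_iota : ∀ x, p (UniversalEnvelopingAlgebra.ι ℂ x)) (h_mul : ∀ u v, p u → p v → p (u * v))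
    (h_add : ∀ u v, p u → p v → p (u + v)) (u : U l) : p u := by
  have hs : Function.Surjective (UniversalEnvelopingAlgebra.mkAlgHom ℂ (sl l)) := fun u => by
    induction u using Quotient.inductionOn' with
    | h t => exact ⟨t, rfl⟩
  obtain ⟨t, rfl⟩ := hs u
  induction t using TensorAlgebra.induction with
  | algebraMap c => rw [AlgHom.commutes]; exact h_algebraMap c
  | ι x => simpa only [UniversalEnvelopingAlgebra.ι_apply] using h_iota x
  | mul a b ha hb => rw [map_mul]; exact h_mul _ _ ha hb
  | add a b ha hb => rw [map_add]; exact h_add _ _ ha hb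

/-- The value of a weight on `E a a`. -/
def wt (χ : Module.Dual ℂ (cartan l)) (a : Fin (l + 1)) : ℂ := χ ⟨E a a, E_diag_mem_cartan a⟩

/-- The cyclic module `U(𝔤) ⧸ I`. -/
def Cyclic (I : Ideal (U l)) : Type := U l ⧸ I

namespace Cyclic

variable (I : Ideal (U l))

instance : AddCommGroup (Cyclic I) := inferInstanceAs (AddCommGroup (U l ⧸ I))

instance : Module (U l) (Cyclic I) := inferInstanceAs (Module (U l) (U l ⧸ I))

instance : Module ℂ (Cyclic I) := inferInstanceAs (Module ℂ (U l ⧸ I))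

instance : IsScalarTower ℂ (U l) (Cyclic I) := inferInstanceAs (IsScalarTower ℂ (U l) (U l ⧸ I))

instance : LieRingModule (sl l) (Cyclic I) where
  bracket x v := UniversalEnvelopingAlgebra.ι ℂ x • v
  add_lie x y v := by
    change UniversalEnvelopingAlgebra.ι ℂ (x + y) • v = _
    rw [map_add, add_smul]
  lie_add x v w := smul_add (UniversalEnvelopingAlgebra.ι ℂ x) v w
  leibniz_lie x y v := by
    change UniversalEnvelopingAlgebra.ι ℂ x • UniversalEnvelopingAlgebra.ι ℂ y • v =
      UniversalEnvelopingAlgebra.ι ℂ ⁅x, y⁆ • v +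
        UniversalEnvelopingAlgebra.ι ℂ y • UniversalEnvelopingAlgebra.ι ℂ x • v
    rw [LieHom.map_lie, LieRing.of_associative_ring_bracket, sub_smul, mul_smul, mul_smul,
      sub_add_cancel]

instance : LieModule ℂ (sl l) (Cyclic I) where
  smul_lie c x v := by
    change UniversalEnvelopingAlgebra.ι ℂ (c • x) • v =
      c • UniversalEnvelopingAlgebra.ι ℂ x • v
    rw [map_smul, smul_assoc]
  lie_smul c x v := by
    change UniversalEnvelopingAlgebra.ι ℂ x • c • v =
      c • UniversalEnvelopingAlgebra.ι ℂ x • v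
    rw [← algebraMap_smul (U l) c v, ← algebraMap_smul (U l) c
      (UniversalEnvelopingAlgebra.ι ℂ x • v), ← mul_smul, ← mul_smul, Algebra.commutes]

/-- The quotient map. -/
def mk : U l →ₗ[U l] Cyclic I := Submodule.mkQ I

theorem mk_surjective : Function.Surjective (mk I) := Submodule.mkQ_surjective I

theorem mk_eq_zero {u : U l} : mk I u = 0 ↔ u ∈ I := Submodule.Quotient.mk_eq_zero I

theorem lie_eq_smul (x : sl l) (m : Cyclic I) :
    ⁅x, m⁆ = UniversalEnvelopingAlgebra.ι ℂ x • m := rfl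

/-- The map between cyclic modules induced by an inclusion of left ideals. -/
def factor {I J : Ideal (U l)} (h : I ≤ J) : Cyclic I →ₗ⁅ℂ, sl l⁆ Cyclic J :=
  { (Submodule.factor h).restrictScalars ℂ with
    map_lie' := fun {x m} =>
      (Submodule.factor h).map_smul (UniversalEnvelopingAlgebra.ι ℂ x) m }

theorem factor_mk {I J : Ideal (U l)} (h : I ≤ J) (u : U l) : factor h (mk I u) = mk J u := rfl

variable {I} in
theorem smul_mem (N : LieSubmodule ℂ (sl l) (Cyclic I)) {m : Cyclic I} (hm : m ∈ N) (u : U l) :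
    u • m ∈ N := by
  induction u using U_induction generalizing m with
  | h_algebraMap c => rw [algebraMap_smul]; exact N.smul_mem c hm
  | h_iota x => exact N.lie_mem hm
  | h_mul u v hu hv => rw [mul_smul]; exact hu (hv hm)
  | h_add u v hu hv => rw [add_smul]; exact add_mem (hu hm) (hv hm)

theorem mem_lieSpan_mk_one (m : Cyclic I) : m ∈ LieSubmodule.lieSpan ℂ (sl l) {mk I 1} := by
  obtain ⟨u, rfl⟩ := mk_surjective I m
  have h : u • mk I 1 ∈ LieSubmodule.lieSpan ℂ (sl l) {mk I 1} :=
    smul_mem _ (LieSubmodule.subset_lieSpan (Set.mem_singleton _)) u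
  rwa [← map_smul, smul_eq_mul, mul_one] at h

theorem isHW_mk_one {χ : Module.Dual ℂ (cartan l)} (h : vermaIdeal l χ ≤ I) :
    IsHW (wt χ) (mk I 1) where
  upper a b hab := by
    rw [lie_eq_smul, ← map_smul, smul_eq_mul, mul_one, mk_eq_zero]
    refine h (Ideal.subset_span (.inl ⟨E a b, fun i j hij => ?_, rfl⟩))
    rw [coe_E_of_ne hab.ne, Matrix.single_apply, if_neg]
    rintro ⟨rfl, rfl⟩
    exact absurd hab hij.not_gt
  diag a := by
    rw [lie_eq_smul, ← algebraMap_smul (U l) (wt χ a), ← sub_eq_zero, ← sub_smul, ← map_smul,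
      smul_eq_mul, mul_one, mk_eq_zero]
    exact h (Ideal.subset_span (.inr ⟨⟨E a a, E_diag_mem_cartan a⟩, rfl⟩))

end Cyclic

theorem map_mem_below {M M' : Type*} [AddCommGroup M] [Module ℂ M] [LieRingModule (sl l) M]
    [LieModule ℂ (sl l) M] [AddCommGroup M'] [Module ℂ M'] [LieRingModule (sl l) M']
    [LieModule ℂ (sl l) M'] (f : M →ₗ⁅ℂ, sl l⁆ M') {s : Fin (l + 1) → ℂ} {μ : ℂ} {m : M}
    (hm : m ∈ below (diagEnd M s) μ) : f m ∈ below (diagEnd M' s) μ := by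
  have : below (diagEnd M s) μ ≤ (below (diagEnd M' s) μ).comap (f : M →ₗ[ℂ] M') := by
    refine iSup_le fun r z hz => mem_below r.2 ?_
    have hz' := congrArg f (Module.End.mem_eigenspace_iff.1 hz)
    rw [diagEnd_apply] at hz' ⊢
    simpa using hz'
  exact this hm

/-- The largest proper left ideal over a proper `vermaIdeal` is proper. -/
theorem maximalIdeal_ne_top {χ : Module.Dual ℂ (cartan l)} (hχ : vermaIdeal l χ ≠ ⊤) :
    maximalIdeal l χ ≠ ⊤ := by
  set I := vermaIdeal l χ
  set s : Fin (l + 1) → ℂ := fun a => -((a : ℕ) : ℂ) with hs_def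
  have hs : IsDecreasing s := by
    intro a b hab
    have : ((a : ℕ) : ℝ) < (b : ℕ) := by exact_mod_cast hab
    refine ⟨(b : ℕ) - (a : ℕ), sub_pos.2 this, ?_⟩
    push_cast
    simp [hs_def]
    ring
  set μ := ∑ a, s a * wt χ a
  -- In a proper quotient the generator is a nonzero vector of the top weight, hence independent of
  -- the lower weight spaces.
  have hone : ∀ J : Ideal (U l), I ≤ J → J ≠ ⊤ → ∀ c : ℂ,
      c • Cyclic.mk J 1 ∈ below (diagEnd (Cyclic J) s) μ → c = 0 := by
    intro J hIJ hJ c hc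
    have h1 : c • Cyclic.mk J 1 = 0 := by
      refine Submodule.disjoint_def.1 (disjoint_below _ μ) _ ?_ hc
      rw [Module.End.mem_eigenspace_iff, map_smul, (Cyclic.isHW_mk_one J hIJ).diagEnd_eq, smul_comm]
    refine (smul_eq_zero.1 h1).resolve_right fun h => hJ ?_
    rwa [Cyclic.mk_eq_zero, ← Ideal.eq_top_iff_one] at h
  -- The elements all of whose left multiples have no top weight component in the Verma module.
  -- Quantifying over `v` makes this a left ideal; it contains every proper `J` over `I`, but not
  -- `1`.
  let S : Ideal (U l) :=
    { carrier := {u | ∀ v : U l, Cyclic.mk I (v * u) ∈ below (diagEnd (Cyclic I) s) μ}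
      zero_mem' := fun v => by simp
      add_mem' := fun hx hy v => by
        rw [mul_add, map_add]
        exact add_mem (hx v) (hy v)
      smul_mem' := fun c x hx v => by
        rw [smul_eq_mul, ← mul_assoc]
        exact hx _ }
  have hle : maximalIdeal l χ ≤ S := by
    refine sSup_le ?_
    rintro J ⟨hIJ, hJ⟩ u hu v
    obtain ⟨c, hc⟩ := (Cyclic.isHW_mk_one I le_rfl).exists_of_mem_lieSpan hs
      (Cyclic.mem_lieSpan_mk_one I (Cyclic.mk I (v * u)))
    -- Since `v * u` dies in the quotient by `J`, its top coefficient `c` vanishes there.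
    have h1 := map_mem_below (Cyclic.factor hIJ) hc
    have h2 : Cyclic.mk J (v * u) = 0 := (Cyclic.mk_eq_zero J).2 (J.mul_mem_left v hu)
    rw [map_sub, map_smul, Cyclic.factor_mk, Cyclic.factor_mk, h2, zero_sub, neg_mem_iff] at h1
    rw [hone J hIJ hJ c h1, zero_smul, sub_zero] at hc
    exact hc
  intro htop
  have h1 : (1 : U l) ∈ S := hle (htop ▸ Submodule.mem_top)
  have h2 := h1 1
  rw [mul_one, ← one_smul ℂ (Cyclic.mk I 1)] at h2
  exact one_ne_zero (hone I le_rfl hχ 1 h2)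

/-- `χ` is the weight of a singular vector in a finite-dimensional module. -/
def IsFiniteWeight (χ : Module.Dual ℂ (cartan l)) : Prop :=
  ∃ (W : Type) (_ : AddCommGroup W) (_ : Module ℂ W) (_ : LieRingModule (sl l) W)
    (_ : LieModule ℂ (sl l) W) (_ : FiniteDimensional ℂ W) (w : W), w ≠ 0 ∧ IsHW (wt χ) w

theorem IsHW.lie_strictUpper {M : Type*} [AddCommGroup M] [Module ℂ M] [LieRingModule (sl l) M]
    [LieModule ℂ (sl l) M] {η : Fin (l + 1) → ℂ} {w : M} (hw : IsHW η w) {x : sl l}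
    (hx : ∀ i j : Fin (l + 1), j ≤ i → (x : Matrix (Fin (l + 1)) (Fin (l + 1)) ℂ) i j = 0) :
    ⁅x, w⁆ = 0 := by
  rw [lie_eq_sum]
  refine Finset.sum_eq_zero fun a _ => Finset.sum_eq_zero fun b _ => ?_
  rcases le_or_gt b a with h | h
  · rw [hx a b h, zero_smul]
  · rw [hw.upper a b h, smul_zero]

theorem IsHW.lie_cartan {M : Type*} [AddCommGroup M] [Module ℂ M] [LieRingModule (sl l) M]
    [LieModule ℂ (sl l) M] {χ : Module.Dual ℂ (cartan l)} {w : M} (hw : IsHW (wt χ) w)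
    (h : cartan l) : ⁅(h : sl l), w⁆ = χ h • w := by
  have h0 : ∀ a b, a ≠ b → ((h : sl l) : Matrix (Fin (l + 1)) (Fin (l + 1)) ℂ) a b = 0 :=
    fun a b hab => h.2 hab
  have h1 : h = ∑ a, ((h : sl l) : Matrix (Fin (l + 1)) (Fin (l + 1)) ℂ) a a •
      (⟨E a a, E_diag_mem_cartan a⟩ : cartan l) := by
    ext1
    conv_lhs => rw [eq_sum_E (h : sl l)]
    rw [AddSubmonoidClass.coe_finsetSum]
    refine Finset.sum_congr rfl fun a _ => ?_
    rw [Finset.sum_eq_single a (fun b _ hb => by rw [h0 a b hb.symm, zero_smul]) (by simp)]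
    rfl
  have h2 : χ h = ∑ a, ((h : sl l) : Matrix (Fin (l + 1)) (Fin (l + 1)) ℂ) a a * wt χ a := by
    conv_lhs => rw [h1]
    simp only [map_sum, map_smul, smul_eq_mul, wt]
  rw [h2, lie_eq_sum, Finset.sum_smul]
  refine Finset.sum_congr rfl fun a _ => ?_
  rw [Finset.sum_eq_single a (fun b _ hb => by rw [h0 a b hb.symm, zero_smul]) (by simp), hw.diag,
    smul_smul]

namespace IsFiniteWeight

variable {χ χ' : Module.Dual ℂ (cartan l)}

/-- `vermaIdeal` lies in the annihilator of a vector of a finite-dimensional module. -/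
theorem exists_linearMap (h : IsFiniteWeight χ) :
    ∃ (W : Type) (_ : AddCommGroup W) (_ : Module ℂ W) (_ : FiniteDimensional ℂ W)
      (φ : U l →ₗ[ℂ] W) (K : Ideal (U l)), vermaIdeal l χ ≤ K ∧ K ≠ ⊤ ∧ ∀ u, φ u = 0 ↔ u ∈ K := by
  obtain ⟨W, _, _, _, _, _, w, hw0, hw⟩ := h
  let ψ : U l →ₐ[ℂ] Module.End ℂ W :=
    UniversalEnvelopingAlgebra.lift ℂ (LieModule.toEnd ℂ (sl l) W)
  let K : Ideal (U l) :=
    { carrier := {u | ψ u w = 0}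
      zero_mem' := by simp
      add_mem' := fun {x y} hx hy => by
        have hx' : ψ x w = 0 := hx
        have hy' : ψ y w = 0 := hy
        simp [hx', hy']
      smul_mem' := fun c x hx => by
        have hx' : ψ x w = 0 := hx
        simp [hx'] }
  have hψ : ∀ x : sl l, ψ (UniversalEnvelopingAlgebra.ι ℂ x) w = ⁅x, w⁆ := fun x => by
    simp only [ψ, UniversalEnvelopingAlgebra.lift_ι_apply, LieModule.toEnd_apply_apply]
  refine ⟨W, _, _, inferInstance, (LinearMap.applyₗ w).comp ψ.toLinearMap, K, ?_, ?_,
    fun u => Iff.rfl⟩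
  · refine Ideal.span_le.2 ?_
    rintro u (⟨x, hx, rfl⟩ | ⟨x, rfl⟩)
    · exact (hψ x).trans (hw.lie_strictUpper hx)
    · change ψ (_ - _) w = 0
      rw [map_sub, LinearMap.sub_apply, hψ, hw.lie_cartan, AlgHom.commutes,
        Module.algebraMap_end_apply, sub_self]
  · rw [Ne, Ideal.eq_top_iff_one]
    intro h1
    have h2 : ψ 1 w = 0 := h1
    exact hw0 (by simpa using h2)

theorem maximalIdeal_ne_top (h : IsFiniteWeight χ) : maximalIdeal l χ ≠ ⊤ := by
  obtain ⟨W, _, _, _, φ, K, hK, hK', -⟩ := h.exists_linearMap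
  exact TypeA.maximalIdeal_ne_top fun htop => hK' (top_le_iff.1 (htop ▸ hK))

/-- The annihilator `K` of a singular vector has finite codimension and is one of the ideals summed
in `maximalIdeal`. -/
theorem finiteDimensional (h : IsFiniteWeight χ) : FiniteDimensional ℂ (V l χ) := by
  obtain ⟨W, _, _, _, φ, K, hK, hK', hφ⟩ := h.exists_linearMap
  have : FiniteDimensional ℂ (U l ⧸ LinearMap.ker φ) :=
    Module.Finite.equiv φ.quotKerEquivRange.symm
  let q : U l →ₗ[ℂ] V l χ := (Cyclic.mk (maximalIdeal l χ)).restrictScalars ℂ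
  have hq : LinearMap.ker φ ≤ LinearMap.ker q := fun u hu =>
    (Cyclic.mk_eq_zero _).2 ((show K ≤ maximalIdeal l χ from le_sSup ⟨hK, hK'⟩) ((hφ u).1 hu))
  refine Module.Finite.of_surjective ((LinearMap.ker φ).liftQ q hq) fun m => ?_
  obtain ⟨u, hu⟩ := Cyclic.mk_surjective _ m
  exact ⟨Submodule.Quotient.mk u, hu⟩

end IsFiniteWeight

/-- The generator of `V l χ`. -/
def hwVec (l : ℕ) (χ : Module.Dual ℂ (cartan l)) : V l χ := Cyclic.mk (maximalIdeal l χ) 1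

theorem mem_lieSpan_hwVec {χ : Module.Dual ℂ (cartan l)} (m : V l χ) :
    m ∈ LieSubmodule.lieSpan ℂ (sl l) {hwVec l χ} :=
  Cyclic.mem_lieSpan_mk_one (maximalIdeal l χ) m

theorem IsFiniteWeight.isHW_hwVec {χ : Module.Dual ℂ (cartan l)} (h : IsFiniteWeight χ) :
    IsHW (wt χ) (hwVec l χ) := by
  obtain ⟨W, _, _, _, φ, K, hK, hK', -⟩ := h.exists_linearMap
  have := Cyclic.isHW_mk_one (maximalIdeal l χ) (hK.trans (le_sSup ⟨hK, hK'⟩))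
  exact ⟨this.1, this.2⟩

theorem IsFiniteWeight.hwVec_ne_zero {χ : Module.Dual ℂ (cartan l)} (h : IsFiniteWeight χ) :
    hwVec l χ ≠ 0 := fun h0 =>
  h.maximalIdeal_ne_top ((Ideal.eq_top_iff_one _).2 ((Cyclic.mk_eq_zero _).1 h0))

end HighestWeightModule

/-! ### Weights realised in finite-dimensional modules. -/

section FiniteWeights

theorem IsHW.tmul {M M' : Type*} [AddCommGroup M] [Module ℂ M] [LieRingModule (sl l) M]
    [LieModule ℂ (sl l) M] [AddCommGroup M'] [Module ℂ M'] [LieRingModule (sl l) M']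
    [LieModule ℂ (sl l) M'] {η θ : Fin (l + 1) → ℂ} {v : M} {w : M'} (hv : IsHW η v)
    (hw : IsHW θ w) : IsHW (η + θ) (v ⊗ₜ[ℂ] w) where
  upper a b hab := by simp [hv.upper a b hab, hw.upper a b hab]
  diag a := by
    simp [hv.diag, hw.diag, add_smul, TensorProduct.smul_tmul']

theorem tmul_ne_zero {M M' : Type*} [AddCommGroup M] [Module ℂ M] [AddCommGroup M'] [Module ℂ M']
    {v : M} {w : M'} (hv : v ≠ 0) (hw : w ≠ 0) : v ⊗ₜ[ℂ] w ≠ 0 := by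
  intro h
  refine hv ((Module.forall_dual_apply_eq_zero_iff ℂ v).1 fun φ => ?_)
  have := congrArg (fun z => TensorProduct.lid ℂ M' (φ.rTensor M' z)) h
  simpa [hw] using this

theorem IsFiniteWeight.add {χ χ' : Module.Dual ℂ (cartan l)} (h : IsFiniteWeight χ)
    (h' : IsFiniteWeight χ') : IsFiniteWeight (χ + χ') := by
  obtain ⟨W, _, _, _, _, _, w, hw0, hw⟩ := h
  obtain ⟨W', _, _, _, _, _, w', hw0', hw'⟩ := h'
  exact ⟨W ⊗[ℂ] W', inferInstance, inferInstance, inferInstance, inferInstance, inferInstance,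
    w ⊗ₜ w', tmul_ne_zero hw0 hw0', hw.tmul hw'⟩

theorem lie_E_single (a b c : Fin (l + 1)) :
    ⁅(E a b : sl l), (Pi.single c 1 : Fin (l + 1) → ℂ)⁆ =
      (if b = c then Pi.single a 1 else 0) -
        (if a = b then (1 / (l + 1) : ℂ) else 0) • Pi.single c 1 := by
  change (E a b : Matrix (Fin (l + 1)) (Fin (l + 1)) ℂ).mulVec (Pi.single c 1) = _
  rw [E, coe_traceless, Matrix.sub_mulVec, Matrix.smul_mulVec, Matrix.one_mulVec]
  congr 1
  · ext i
    by_cases h : b = c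
    · subst h; simp [Matrix.single_apply, Pi.single_apply, eq_comm]
    · simp [h]
  · by_cases h : a = b
    · subst h; simp
    · simp [h, Matrix.trace_single_eq_of_ne a b _ h]

theorem wt_fundamentalWeight (i : Fin l) (a : Fin (l + 1)) :
    wt (fundamentalWeight l i) a = (if (a : ℕ) ≤ i then 1 else 0) - (i + 1) / (l + 1) := by
  have hcard : (Finset.univ.filter fun j : Fin (l + 1) => (j : ℕ) ≤ i) = Finset.Iic i.castSucc := by
    ext j; simp [Fin.le_iff_val_le_val]
  have h : ∀ j : Fin (l + 1), (E a a : Matrix (Fin (l + 1)) (Fin (l + 1)) ℂ) j j =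
      (if a = j then 1 else 0) - 1 / (l + 1) := by
    intro j
    by_cases h : a = j
    · subst h; simp [E]
    · simp [E, h]
  change ∑ j ∈ Finset.univ.filter (fun j : Fin (l + 1) => (j : ℕ) ≤ i),
    (E a a : Matrix (Fin (l + 1)) (Fin (l + 1)) ℂ) j j = _
  simp only [h, Finset.sum_sub_distrib, Finset.sum_ite_eq,
    Finset.sum_const, hcard, Fin.card_Iic, nsmul_eq_mul]
  simp [div_eq_mul_inv, Fin.le_iff_val_le_val]

theorem isFiniteWeight_zero : IsFiniteWeight (0 : Module.Dual ℂ (cartan l)) := by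
  let _ : LieRingModule (sl l) ℂ :=
    { bracket := fun _ _ => 0
      add_lie := by simp
      lie_add := by simp
      leibniz_lie := by simp }
  have : LieModule ℂ (sl l) ℂ := ⟨fun _ _ _ => (smul_zero _).symm, fun _ _ _ => (smul_zero _).symm⟩
  exact ⟨ℂ, inferInstance, inferInstance, inferInstance, inferInstance, inferInstance, 1,
    one_ne_zero, fun _ _ _ => rfl, fun _ => (zero_smul ℂ (1 : ℂ)).symm⟩

theorem isFiniteWeight_fundamentalWeight_zero (hl : 0 < l) :
    IsFiniteWeight (fundamentalWeight l ⟨0, hl⟩) := by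
  refine ⟨Fin (l + 1) → ℂ, inferInstance, inferInstance, inferInstance, inferInstance,
    inferInstance, Pi.single 0 1, by simp, fun a b hab => ?_, fun a => ?_⟩
  · have hb : b ≠ 0 := (Fin.pos_of_ne_zero (by rintro rfl; simp at hab)).ne'
    rw [lie_E_single, if_neg hb, if_neg hab.ne, zero_smul, sub_zero]
  · rw [lie_E_single, wt_fundamentalWeight, sub_smul, if_pos rfl]
    by_cases h : a = 0
    · subst h; simp
    · have : ¬ (a : ℕ) ≤ 0 := fun hle => h (Fin.ext (Nat.le_zero.1 hle))
      rw [if_neg h, if_neg this]; simp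

/-- This is `e₀ ∧ e₁` in the tensor square of the natural module: a strictly upper matrix unit can
only send `e₁` to `e₀`, and `e₀ ∧ e₀ = 0`. -/
theorem isHW_wedge {M : Type*} [AddCommGroup M] [Module ℂ M] [LieRingModule (sl l) M]
    [LieModule ℂ (sl l) M] (v : Fin (l + 1) → M)
    (hv : ∀ a b c, ⁅(E a b : sl l), v c⁆ =
      (if b = c then v a else 0) - (if a = b then (1 / (l + 1) : ℂ) else 0) • v c)
    (hl : 1 < l) {q : Fin (l + 1)} (hq : (q : ℕ) = 1) :
    IsHW (wt (fundamentalWeight l ⟨1, hl⟩)) (v 0 ⊗ₜ[ℂ] v q - v q ⊗ₜ[ℂ] v 0) where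
  upper a b hab := by
    have hb : b ≠ 0 := (Fin.pos_of_ne_zero (by rintro rfl; simp at hab)).ne'
    simp only [lie_sub, TensorProduct.LieModule.lie_tmul_right, hv, if_neg hb, if_neg hab.ne, zero_smul, sub_zero, TensorProduct.zero_tmul, TensorProduct.tmul_zero,
      zero_add, add_zero]
    by_cases hbq : b = q
    · have ha : a = 0 := by
        rw [hbq, Fin.lt_def, hq] at hab
        exact Fin.ext (by simpa using hab)
      simp [ha, hbq]
    · simp [hbq]
  diag a := by
    have hq0 : (0 : Fin (l + 1)) ≠ q := by rw [Ne, Fin.ext_iff, hq]; simp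
    simp only [lie_sub, TensorProduct.LieModule.lie_tmul_right, hv, wt_fundamentalWeight, if_true]
    by_cases h0 : a = 0
    · subst h0
      rw [if_neg hq0, if_pos rfl, if_pos (by simp)]
      simp only [TensorProduct.sub_tmul, TensorProduct.tmul_sub, TensorProduct.zero_tmul,
        TensorProduct.tmul_zero, TensorProduct.tmul_smul, ← TensorProduct.smul_tmul']
      push_cast
      module
    · rw [if_neg h0]
      by_cases h1 : a = q
      · subst h1
        rw [if_pos rfl, if_pos (by simp [hq])]
        simp only [TensorProduct.sub_tmul, TensorProduct.tmul_sub, TensorProduct.zero_tmul,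
          TensorProduct.tmul_zero, TensorProduct.tmul_smul, ← TensorProduct.smul_tmul']
        push_cast
        module
      · have : ¬ (a : ℕ) ≤ 1 := by
          intro h
          have h0' : (a : ℕ) ≠ 0 := fun h => h0 (Fin.ext h)
          rw [Fin.ext_iff] at h1
          omega
        rw [if_neg h1, if_neg this]
        simp only [TensorProduct.sub_tmul, TensorProduct.tmul_sub, TensorProduct.zero_tmul,
          TensorProduct.tmul_zero, TensorProduct.tmul_smul, ← TensorProduct.smul_tmul']
        push_cast
        module

theorem wedge_ne_zero {M : Type*} [AddCommGroup M] [Module ℂ M] {v w : M} (φ : Module.Dual ℂ M)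
    (hv : φ v = 1) (hw : φ w = 0) (h : w ≠ 0) : v ⊗ₜ[ℂ] w - w ⊗ₜ[ℂ] v ≠ 0 := by
  intro h0
  have := congrArg (fun z => TensorProduct.lid ℂ M (φ.rTensor M z)) h0
  simp [hv, hw, h] at this

theorem isFiniteWeight_wedge {M : Type} [AddCommGroup M] [Module ℂ M] [LieRingModule (sl l) M]
    [LieModule ℂ (sl l) M] [FiniteDimensional ℂ M] (v : Fin (l + 1) → M)
    (hv : ∀ a b c, ⁅(E a b : sl l), v c⁆ =
      (if b = c then v a else 0) - (if a = b then (1 / (l + 1) : ℂ) else 0) • v c)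
    (hl : 1 < l) {q : Fin (l + 1)} (hq : (q : ℕ) = 1) (φ : Module.Dual ℂ M)
    (h0 : φ (v 0) = 1) (h1 : φ (v q) = 0) (h : v q ≠ 0) :
    IsFiniteWeight (fundamentalWeight l ⟨1, hl⟩) :=
  ⟨M ⊗[ℂ] M, inferInstance, inferInstance, inferInstance, inferInstance, inferInstance, _,
    wedge_ne_zero φ h0 h1 h, isHW_wedge v hv hl hq⟩

theorem isFiniteWeight_fundamentalWeight_one (hl : 1 < l) :
    IsFiniteWeight (fundamentalWeight l ⟨1, hl⟩) := by
  set q : Fin (l + 1) := ⟨1, by omega⟩ with hq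
  have hq0 : (0 : Fin (l + 1)) ≠ q := by simp [hq, Fin.ext_iff]
  exact isFiniteWeight_wedge (fun c => (Pi.single c 1 : Fin (l + 1) → ℂ)) lie_E_single hl (q := q)
    rfl (LinearMap.proj 0) (by simp) (Pi.single_eq_of_ne hq0 1) (by simp)

theorem IsFiniteWeight.nsmul {χ : Module.Dual ℂ (cartan l)} (h : IsFiniteWeight χ) (n : ℕ) :
    IsFiniteWeight (n • χ) := by
  induction n with
  | zero => rw [zero_smul]; exact isFiniteWeight_zero
  | succ n ih => rw [succ_nsmul]; exact ih.add h

/-- Tensoring singular vectors adds their weights. Combinations of `ω₁` and `ω₂` suffice: they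
include `kω₁`, the chosen `ν`, and every dominant weight in rank one. -/
theorem isFiniteWeight_dominantWeight {a : Fin l → ℕ} (ha : ∀ i : Fin l, 1 < (i : ℕ) → a i = 0) :
    IsFiniteWeight (dominantWeight l a) := by
  refine Finset.sum_induction _ _ (fun _ _ => IsFiniteWeight.add) isFiniteWeight_zero ?_
  rintro ⟨i, hi⟩ -
  match i with
  | 0 => exact (isFiniteWeight_fundamentalWeight_zero hi).nsmul _
  | 1 => exact (isFiniteWeight_fundamentalWeight_one hi).nsmul _
  | i + 2 => rw [ha ⟨i + 2, hi⟩ (by simp), zero_smul]; exact isFiniteWeight_zero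

theorem wt_dominantWeight_sub (a : Fin l → ℕ) (i : Fin l) :
    wt (dominantWeight l a) i.castSucc - wt (dominantWeight l a) i.succ = a i := by
  have h : ∀ b, wt (dominantWeight l a) b = ∑ j, (a j : ℂ) * wt (fundamentalWeight l j) b := by
    intro b
    simp [wt, dominantWeight, LinearMap.sum_apply]
  rw [h, h, ← Finset.sum_sub_distrib, Finset.sum_eq_single i]
  · simp [wt_fundamentalWeight]
    ring
  · intro j _ hj
    rw [← mul_sub, wt_fundamentalWeight, wt_fundamentalWeight]
    have : ((i.castSucc : ℕ) ≤ j) ↔ ((i.succ : ℕ) ≤ j) := by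
      have := Fin.val_ne_of_ne hj
      simp
      omega
    simp only [this, sub_self, mul_zero]
  · simp

end FiniteWeights

/-! ### Singular vectors in tensor products; rank at least two. -/

section Singular

variable {M : Type*} [AddCommGroup M] [Module ℂ M] [LieRingModule (sl l) M] [LieModule ℂ (sl l) M]
variable {M' : Type*} [AddCommGroup M'] [Module ℂ M'] [LieRingModule (sl l) M']
  [LieModule ℂ (sl l) M']

/-- `m` is a weight vector of weight `η` (or zero). -/
def HasWeight (η : Fin (l + 1) → ℂ) (m : M) : Prop := ∀ a, ⁅(E a a : sl l), m⁆ = η a • m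

/-- The simple root vector `E i (i + 1)`. -/
abbrev simpleE (i : Fin l) : sl l := E i.castSucc i.succ

/-- The opposite simple root vector `E (i + 1) i`. -/
abbrev simpleF (i : Fin l) : sl l := E i.succ i.castSucc

/-- The weight `η` minus the simple root `i`. -/
def lowerWeight (η : Fin (l + 1) → ℂ) (i : Fin l) : Fin (l + 1) → ℂ :=
  η + Pi.single i.succ 1 - Pi.single i.castSucc 1

theorem HasWeight.simpleF {η : Fin (l + 1) → ℂ} {m : M} (h : HasWeight η m) (i : Fin l) :
    HasWeight (lowerWeight η i) ⁅simpleF i, m⁆ := by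
  intro a
  rw [E_lie_E_lie, h a, lie_smul, lowerWeight]
  by_cases h1 : a = i.succ
  · subst h1
    have := i.castSucc_lt_succ.ne
    simp [this, this.symm, add_smul]
  · by_cases h2 : a = i.castSucc
    · subst h2; simp [h1, sub_smul]
    · simp [h1, h2, Ne.symm h2]

theorem HasWeight.tmul {η θ : Fin (l + 1) → ℂ} {v : M} {w : M'} (hv : HasWeight η v)
    (hw : HasWeight θ w) : HasWeight (η + θ) (v ⊗ₜ[ℂ] w) := by
  intro a
  rw [TensorProduct.LieModule.lie_tmul_right, hv a, hw a]
  simp [add_smul, TensorProduct.smul_tmul']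

theorem HasWeight.add {η : Fin (l + 1) → ℂ} {m m' : M} (h : HasWeight η m) (h' : HasWeight η m') :
    HasWeight η (m + m') := fun a => by rw [lie_add, h a, h' a, smul_add]

theorem HasWeight.smul {η : Fin (l + 1) → ℂ} {m : M} (h : HasWeight η m) (c : ℂ) :
    HasWeight η (c • m) := fun a => by rw [lie_smul, h a, smul_comm]

theorem HasWeight.simpleE_lie_simpleF {η : Fin (l + 1) → ℂ} {m : M} (h : HasWeight η m)
    (i j : Fin l) : ⁅simpleE i, ⁅TypeA.simpleF j, m⁆⁆ = ⁅TypeA.simpleF j, ⁅simpleE i, m⁆⁆ +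
      (if i = j then η j.castSucc - η j.succ else 0) • m := by
  rw [E_lie_E_lie, add_sub_assoc]
  by_cases hij : i = j
  · subst hij; simp [h _, sub_smul]
  · simp [hij, Ne.symm hij]

/-- The simple root vectors generate the strictly upper triangular matrices, as `E a (i+1) = ⁅E a i,
E i (i+1)⁆` for `a < i`. -/
theorem HasWeight.isHW {η : Fin (l + 1) → ℂ} {m : M} (h : HasWeight η m)
    (hm : ∀ i : Fin l, ⁅simpleE i, m⁆ = 0) : IsHW η m where
  diag := h
  upper a b hab := by
    induction b using Fin.induction with
    | zero => simp at hab
    | succ i ih =>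
      rcases (Fin.le_castSucc_iff.2 hab).lt_or_eq with h1 | rfl
      · have h2 : (E a i.succ : sl l) = ⁅(E a i.castSucc : sl l), simpleE i⁆ := by
          simp [simpleE, lie_E, hab.ne']
        rw [h2, lie_lie, hm i, ih h1]
        simp
      · exact hm i

theorem IsHW.simpleF_lie_eq_zero [FiniteDimensional ℂ M] {η : Fin (l + 1) → ℂ} {v : M}
    (hv : IsHW η v) (hv0 : v ≠ 0) {i : Fin l} (h : η i.castSucc = η i.succ) :
    ⁅simpleF i, v⁆ = 0 := by
  have := (hv.hasPrimitiveVectorWith hv0 i.castSucc_lt_succ).pow_toEnd_f_eq_zero_of_eq_nat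
    (n := 0) (by simp [h])
  simpa using this

/-- The singular vector of weight `η + θ - 2 α_i`. -/
theorem exists_isHW_lower_twice {η θ : Fin (l + 1) → ℂ} {v : M} {w : M'} (hv : IsHW η v)
    (hw : IsHW θ w) (hv0 : v ≠ 0) (hw0 : w ≠ 0) (i : Fin l) {k : ℂ}
    (hη : η i.castSucc - η i.succ = k) (hk0 : k ≠ 0) (hk1 : k ≠ 1)
    (hθ : θ i.castSucc - θ i.succ = 2) :
    ∃ t : M ⊗[ℂ] M', t ≠ 0 ∧ IsHW (lowerWeight (lowerWeight (η + θ) i) i) t := by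
  have wv : HasWeight η v := hv.diag
  have ww : HasWeight θ w := hw.diag
  have ev : ∀ j : Fin l, ⁅simpleE j, v⁆ = 0 := fun j => hv.upper _ _ j.castSucc_lt_succ
  have ew : ∀ j : Fin l, ⁅simpleE j, w⁆ = 0 := fun j => hw.upper _ _ j.castSucc_lt_succ
  have hne : i.castSucc ≠ i.succ := i.castSucc_lt_succ.ne
  have hη' : lowerWeight η i i.castSucc - lowerWeight η i i.succ = k - 2 := by
    simp [lowerWeight, hne, hne.symm]
    linear_combination hη
  have hθ' : lowerWeight θ i i.castSucc - lowerWeight θ i i.succ = 0 := by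
    simp [lowerWeight, hne, hne.symm]
    linear_combination hθ
  have efv : ∀ j, ⁅simpleE j, ⁅simpleF i, v⁆⁆ = (if j = i then k else 0) • v := fun j => by
    rw [wv.simpleE_lie_simpleF, ev, lie_zero, zero_add, hη]
  have efw : ∀ j, ⁅simpleE j, ⁅simpleF i, w⁆⁆ = (if j = i then 2 else 0 : ℂ) • w := fun j => by
    rw [ww.simpleE_lie_simpleF, ew, lie_zero, zero_add, hθ]
  have effv : ∀ j, ⁅simpleE j, ⁅simpleF i, ⁅simpleF i, v⁆⁆⁆ =
      (if j = i then 2 * (k - 1) else 0) • ⁅simpleF i, v⁆ := fun j => by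
    rw [(wv.simpleF i).simpleE_lie_simpleF, efv, hη', lie_smul, ← add_smul]
    split_ifs <;> ring_nf
  have effw : ∀ j, ⁅simpleE j, ⁅simpleF i, ⁅simpleF i, w⁆⁆⁆ =
      (if j = i then 2 else 0 : ℂ) • ⁅simpleF i, w⁆ := fun j => by
    rw [(ww.simpleF i).simpleE_lie_simpleF, efw, hθ', lie_smul, ← add_smul]
    split_ifs <;> ring_nf
  -- For coefficients `c₀, c₁, c₂`, vanishing under `simpleE i` means `2c₀ + k c₁ = 0` and `c₁ +
  -- (k-1) c₂ = 0`; the solution is normalized by `c₂ = 2`.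
  refine ⟨(k * (k - 1)) • v ⊗ₜ ⁅simpleF i, ⁅simpleF i, w⁆⁆ +
    (-2 * (k - 1)) • ⁅simpleF i, v⁆ ⊗ₜ ⁅simpleF i, w⁆ +
    (2 : ℂ) • ⁅simpleF i, ⁅simpleF i, v⁆⁆ ⊗ₜ w, fun h0 => ?_, HasWeight.isHW ?_ fun j => ?_⟩
  -- Raising the first factor twice isolates the last term and leaves `4k(k-1) v ⊗ w`.
  · have h1 := congrArg (fun z => (LieModule.toEnd ℂ (sl l) M (simpleE i)).rTensor M'
      ((LieModule.toEnd ℂ (sl l) M (simpleE i)).rTensor M' z)) h0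
    simp only [map_add, map_smul, LinearMap.rTensor_tmul, LieModule.toEnd_apply_apply, ev, efv,
      effv, TensorProduct.zero_tmul, smul_zero, zero_add, if_true,
      ← TensorProduct.smul_tmul', smul_smul, map_zero] at h1
    refine smul_ne_zero ?_ (tmul_ne_zero hv0 hw0) h1
    simp [hk0, sub_ne_zero.2 hk1]
  · refine ((HasWeight.smul ?_ _).add (HasWeight.smul ?_ _)).add (HasWeight.smul ?_ _)
    · convert wv.tmul ((ww.simpleF i).simpleF i) using 1
      simp only [lowerWeight]; abel
    · convert (wv.simpleF i).tmul (ww.simpleF i) using 1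
      simp only [lowerWeight]; abel
    · convert ((wv.simpleF i).simpleF i).tmul ww using 1
      simp only [lowerWeight]; abel
  · simp only [lie_add, lie_smul, TensorProduct.LieModule.lie_tmul_right, ev, ew, efv, efw, effv,
      effw, TensorProduct.zero_tmul, TensorProduct.tmul_zero, zero_add, add_zero,
      ← TensorProduct.smul_tmul', TensorProduct.tmul_smul]
    split_ifs
    · module
    · simp

/-- The singular vector of weight `η + θ - α_i - α_j` for adjacent simple roots. -/
theorem exists_isHW_lower_adjacent {η θ : Fin (l + 1) → ℂ} {v : M} {w : M'} (hv : IsHW η v)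
    (hw : IsHW θ w) (hv0 : v ≠ 0) (hw0 : w ≠ 0) {i j : Fin l} (hij : i.succ = j.castSucc) {k a b : ℂ}
    (hfv : ⁅simpleF j, v⁆ = 0)
    (hηi : η i.castSucc - η i.succ = k) (hηj : η j.castSucc - η j.succ = 0) (hk0 : k ≠ 0)
    (hθi : θ i.castSucc - θ i.succ = a) (hθj : θ j.castSucc - θ j.succ = b) (hb : b ≠ 0)
    (hab : a + b + 1 ≠ 0) :
    ∃ t : M ⊗[ℂ] M', t ≠ 0 ∧ IsHW (lowerWeight (lowerWeight (η + θ) i) j) t := by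
  have wv : HasWeight η v := hv.diag
  have ww : HasWeight θ w := hw.diag
  have ev : ∀ j : Fin l, ⁅simpleE j, v⁆ = 0 := fun j => hv.upper _ _ j.castSucc_lt_succ
  have ew : ∀ j : Fin l, ⁅simpleE j, w⁆ = 0 := fun j => hw.upper _ _ j.castSucc_lt_succ
  have h1 : i.castSucc ≠ i.succ := i.castSucc_lt_succ.ne
  have h2 : j.castSucc ≠ j.succ := j.castSucc_lt_succ.ne
  have h3 : i.castSucc ≠ j.succ :=
    (i.castSucc_lt_succ.trans (hij ▸ j.castSucc_lt_succ)).ne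
  have hji : j ≠ i := by
    rintro rfl
    exact h1 hij.symm
  rw [← hij] at h2 hηj hθj
  have hη' : lowerWeight η i j.castSucc - lowerWeight η i j.succ = 1 := by
    rw [← hij]
    simp [lowerWeight, h1.symm, h2.symm, h3.symm]
    linear_combination hηj
  have hθ' : lowerWeight θ i j.castSucc - lowerWeight θ i j.succ = b + 1 := by
    rw [← hij]
    simp [lowerWeight, h1.symm, h2.symm, h3.symm]
    linear_combination hθj
  have hθ'' : lowerWeight θ j i.castSucc - lowerWeight θ j i.succ = a + 1 := by
    rw [hij]
    simp [lowerWeight, ← hij, h1, h2, h3]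
    linear_combination hθi
  rw [hij] at hηj hθj
  have efv : ∀ p, ⁅simpleE p, ⁅simpleF i, v⁆⁆ = (if p = i then k else 0) • v := fun p => by
    rw [wv.simpleE_lie_simpleF, ev, lie_zero, zero_add, hηi]
  have efiw : ∀ p, ⁅simpleE p, ⁅simpleF i, w⁆⁆ = (if p = i then a else 0) • w := fun p => by
    rw [ww.simpleE_lie_simpleF, ew, lie_zero, zero_add, hθi]
  have efjw : ∀ p, ⁅simpleE p, ⁅simpleF j, w⁆⁆ = (if p = j then b else 0) • w := fun p => by
    rw [ww.simpleE_lie_simpleF, ew, lie_zero, zero_add, hθj]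
  have effv : ∀ p, ⁅simpleE p, ⁅simpleF j, ⁅simpleF i, v⁆⁆⁆ =
      (if p = j then 1 else 0 : ℂ) • ⁅simpleF i, v⁆ := fun p => by
    rw [(wv.simpleF i).simpleE_lie_simpleF, efv, hη', lie_smul, hfv, smul_zero, zero_add]
  have efjiw : ∀ p, ⁅simpleE p, ⁅simpleF j, ⁅simpleF i, w⁆⁆⁆ =
      (if p = i then a else 0) • ⁅simpleF j, w⁆ +
        (if p = j then b + 1 else 0 : ℂ) • ⁅simpleF i, w⁆ := fun p => by
    rw [(ww.simpleF i).simpleE_lie_simpleF, efiw, hθ', lie_smul]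
  have efijw : ∀ p, ⁅simpleE p, ⁅simpleF i, ⁅simpleF j, w⁆⁆⁆ =
      (if p = j then b else 0) • ⁅simpleF i, w⁆ +
        (if p = i then a + 1 else 0 : ℂ) • ⁅simpleF j, w⁆ := fun p => by
    rw [(ww.simpleF j).simpleE_lie_simpleF, efjw, hθ'', lie_smul]
  -- Since `simpleF j` kills `v`, four terms suffice. With coefficients `A, B, C, D`, vanishing
  -- under `simpleE i` and `simpleE j` means `(a+1)A + aB + kC = 0`, `bA + (b+1)B = 0` and `bC + D =
  -- 0`.
  refine ⟨(k * (b + 1)) • v ⊗ₜ ⁅simpleF i, ⁅simpleF j, w⁆⁆ +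
    (-(k * b)) • v ⊗ₜ ⁅simpleF j, ⁅simpleF i, w⁆⁆ +
    (-(a + b + 1)) • ⁅simpleF i, v⁆ ⊗ₜ ⁅simpleF j, w⁆ +
    (b * (a + b + 1)) • ⁅simpleF j, ⁅simpleF i, v⁆⁆ ⊗ₜ w, fun h0 => ?_, HasWeight.isHW ?_ fun p => ?_⟩
  -- Applying `simpleE j` and then `simpleE i` to the first factor isolates the last term and leaves
  -- `k b (a+b+1) v ⊗ w`.
  · have h1 := congrArg (fun z => (LieModule.toEnd ℂ (sl l) M (simpleE i)).rTensor M'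
      ((LieModule.toEnd ℂ (sl l) M (simpleE j)).rTensor M' z)) h0
    simp only [map_add, map_smul, LinearMap.rTensor_tmul, LieModule.toEnd_apply_apply, ev, efv,
      effv, TensorProduct.zero_tmul, smul_zero, zero_add, if_true, if_neg hji,
      ← TensorProduct.smul_tmul', smul_smul, map_zero, zero_smul] at h1
    refine smul_ne_zero ?_ (tmul_ne_zero hv0 hw0) h1
    simp [hk0, hb, hab]
  · refine (((HasWeight.smul ?_ _).add (HasWeight.smul ?_ _)).add (HasWeight.smul ?_ _)).add
      (HasWeight.smul ?_ _)
    · convert wv.tmul ((ww.simpleF j).simpleF i) using 1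
      simp only [lowerWeight]; abel
    · convert wv.tmul ((ww.simpleF i).simpleF j) using 1
      simp only [lowerWeight]; abel
    · convert (wv.simpleF i).tmul (ww.simpleF j) using 1
      simp only [lowerWeight]; abel
    · convert ((wv.simpleF i).simpleF j).tmul ww using 1
      simp only [lowerWeight]; abel
  · simp only [lie_add, lie_smul, TensorProduct.LieModule.lie_tmul_right, ev, ew, efv, efjw,
      effv, efjiw, efijw, TensorProduct.zero_tmul, TensorProduct.tmul_zero, zero_add, add_zero,
      ← TensorProduct.smul_tmul', TensorProduct.tmul_smul, TensorProduct.tmul_add]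
    by_cases hpi : p = i
    · subst hpi
      simp only [if_true, if_neg hji.symm]
      module
    · by_cases hpj : p = j
      · subst hpj
        simp only [if_true, if_neg hji]
        module
      · simp [hpi, hpj]

/-- In `(θ - α, θ - α + 2ρ)` the terms `(α, α)` and `-2(ρ, α)` cancel for a simple root `α`. -/
theorem casimirScalar_lowerWeight (θ : Fin (l + 1) → ℂ) (i : Fin l) :
    casimirScalar (lowerWeight θ i) = casimirScalar θ + 2 * (θ i.succ - θ i.castSucc) := by
  have hne : i.castSucc ≠ i.succ := i.castSucc_lt_succ.ne
  have h : ∀ a, lowerWeight θ i a ^ 2 + (l - 2 * (a : ℕ)) * lowerWeight θ i a =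
      (θ a ^ 2 + (l - 2 * (a : ℕ)) * θ a) +
        (if a = i.succ then 2 * θ i.succ + 1 + (l - 2 * (i + 1)) else 0) +
        (if a = i.castSucc then -2 * θ i.castSucc + 1 - (l - 2 * i) else 0) := by
    intro a
    by_cases h1 : a = i.succ
    · subst h1
      simp [lowerWeight, hne.symm]
      ring
    · by_cases h2 : a = i.castSucc
      · subst h2
        simp [lowerWeight, hne]
        ring
      · simp [lowerWeight, h1, h2]
  simp only [casimirScalar, h, Finset.sum_add_distrib, Finset.sum_ite_eq', Finset.mem_univ, if_true]
  ring

theorem casimir_V {χ : Module.Dual ℂ (cartan l)} (h : IsFiniteWeight χ) :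
    casimir (l := l) (V l χ) = casimirScalar (wt χ) • LinearMap.id :=
  LinearMap.ext fun m => casimir_eq_of_mem_lieSpan h.isHW_hwVec.casimir_eq (mem_lieSpan_hwVec m)

theorem casimir_tensor_V {ι : Type*} [Fintype ι] [DecidableEq ι] {x : Module.Basis ι ℂ (sl l)}
    {xs : ι → sl l} (hx : IsKillingDual x xs) {χ χ' : Module.Dual ℂ (cartan l)}
    (h : IsFiniteWeight χ) (h' : IsFiniteWeight χ') (t : V l χ ⊗[ℂ] V l χ') :
    casimir (l := l) (V l χ ⊗[ℂ] V l χ') t =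
      (casimirScalar (wt χ) + casimirScalar (wt χ')) • t +
        (4 * (l + 1) : ℂ) • casimirM x xs χ χ' t := by
  rw [hx.casimir_tensor (V l χ) (V l χ'), casimir_V h, casimir_V h', casimirM]
  simp [add_smul]

theorem isComponentWithEigenvalue_lieSpan {ι : Type*} [Fintype ι] [DecidableEq ι]
    {x : Module.Basis ι ℂ (sl l)} {xs : ι → sl l} (hx : IsKillingDual x xs)
    {χ χ' : Module.Dual ℂ (cartan l)} (h : IsFiniteWeight χ) (h' : IsFiniteWeight χ')
    {η : Fin (l + 1) → ℂ} {t : V l χ ⊗[ℂ] V l χ'} (ht : IsHW η t) (ht0 : t ≠ 0) :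
    IsComponentWithEigenvalue (casimirM x xs χ χ') (LieSubmodule.lieSpan ℂ (sl l) {t})
      ((4 * (l + 1) : ℂ)⁻¹ *
        (casimirScalar η - (casimirScalar (wt χ) + casimirScalar (wt χ')))) := by
  have := h.finiteDimensional
  have := h'.finiteDimensional
  refine ⟨ht.isIrreducible ht0, fun y hy => ?_⟩
  have h1 := casimir_eq_of_mem_lieSpan ht.casimir_eq hy
  have hl : (4 * (l + 1) : ℂ) ≠ 0 := by
    have : ((l : ℂ) + 1) ≠ 0 := by exact_mod_cast l.succ_ne_zero
    simpa using this
  rw [casimir_tensor_V hx h h', ← eq_sub_iff_add_eq', ← sub_smul] at h1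
  rw [mul_smul, ← h1, inv_smul_smul₀ hl]

/-- In rank at least two there are non-isomorphic components with the same eigenvalue. -/
theorem exists_components {ι : Type*} [Fintype ι] [DecidableEq ι] {k : ℕ} (hl : 2 ≤ l) (hk : 2 ≤ k)
    {x : Module.Basis ι ℂ (sl l)} {xs : ι → sl l} (hx : IsKillingDual x xs) :
    ∃ (a : Fin l → ℕ) (N₁ N₂ : LieSubmodule ℂ (sl l)
        (V l (dominantWeight l (kOmegaOne l k)) ⊗[ℂ] V l (dominantWeight l a))) (c : ℂ),
      ¬ Nonempty (N₁ ≃ₗ⁅ℂ, sl l⁆ N₂) ∧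
      IsComponentWithEigenvalue (casimirM x xs _ _) N₁ c ∧
      IsComponentWithEigenvalue (casimirM x xs _ _) N₂ c := by
  -- The weight `2ω₁ + (k-1)ω₂`: the sum `μ` of the two highest weights pairs to `k+2` and `k-1`
  -- with the first two coroots, so `μ - α₁` pairs to `k` with both. The hypothesis `2 ≤ k` keeps `k
  -- - 1` nonzero.
  set a : Fin l → ℕ := fun i => if (i : ℕ) = 0 then 2 else if (i : ℕ) = 1 then k - 1 else 0 with ha
  set χ := dominantWeight l (kOmegaOne l k)
  set χ' := dominantWeight l a
  have h : IsFiniteWeight χ := isFiniteWeight_dominantWeight fun i hi => by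
    simp [kOmegaOne]; omega
  have h' : IsFiniteWeight χ' := isFiniteWeight_dominantWeight fun i hi => by
    rw [ha]
    simp only
    rw [if_neg (by omega), if_neg (by omega)]
  have := h.finiteDimensional
  have := h'.finiteDimensional
  let i : Fin l := ⟨0, by omega⟩
  let j : Fin l := ⟨1, by omega⟩
  have hij : i.succ = j.castSucc := rfl
  have hηi : wt χ i.castSucc - wt χ i.succ = k := by
    rw [wt_dominantWeight_sub]; simp [kOmegaOne, i]
  have hηj : wt χ j.castSucc - wt χ j.succ = 0 := by
    rw [wt_dominantWeight_sub]; simp [kOmegaOne, j]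
  have hθi : wt χ' i.castSucc - wt χ' i.succ = 2 := by
    rw [wt_dominantWeight_sub]; simp [ha, i]
  have hθj : wt χ' j.castSucc - wt χ' j.succ = k - 1 := by
    rw [wt_dominantWeight_sub]; simp [ha, j, Nat.cast_sub (by omega : 1 ≤ k)]
  have hk0 : (k : ℂ) ≠ 0 := by exact_mod_cast (by omega : k ≠ 0)
  have hk1 : (k : ℂ) ≠ 1 := by exact_mod_cast (by omega : k ≠ 1)
  have hk2 : (2 : ℂ) + (k - 1) + 1 ≠ 0 := by
    have : ((k + 2 : ℕ) : ℂ) ≠ 0 := by exact_mod_cast (by omega : k + 2 ≠ 0)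
    intro h0
    apply this
    push_cast
    linear_combination h0
  obtain ⟨t₁, h10, h1⟩ := exists_isHW_lower_twice h.isHW_hwVec h'.isHW_hwVec h.hwVec_ne_zero
    h'.hwVec_ne_zero i hηi hk0 hk1 hθi
  obtain ⟨t₂, h20, h2⟩ := exists_isHW_lower_adjacent h.isHW_hwVec h'.isHW_hwVec h.hwVec_ne_zero
    h'.hwVec_ne_zero hij
    (h.isHW_hwVec.simpleF_lie_eq_zero h.hwVec_ne_zero (sub_eq_zero.1 hηj))
    hηi hηj hk0 hθi hθj (sub_ne_zero.2 hk1) hk2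
  have e1 : i.castSucc ≠ i.succ := i.castSucc_lt_succ.ne
  have e2 : i.succ ≠ j.succ := hij ▸ j.castSucc_lt_succ.ne
  have e3 : i.castSucc ≠ j.succ :=
    (i.castSucc_lt_succ.trans (hij ▸ j.castSucc_lt_succ)).ne
  have hc : casimirScalar (lowerWeight (lowerWeight (wt χ + wt χ') i) i) =
      casimirScalar (lowerWeight (lowerWeight (wt χ + wt χ') i) j) := by
    rw [casimirScalar_lowerWeight _ i, casimirScalar_lowerWeight _ j, ← hij]
    rw [← hij] at hηj hθj
    simp [lowerWeight, e1, e1.symm, e2.symm, e3.symm]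
    linear_combination hθj + hηj - hθi - hηi
  refine ⟨a, _, _, _, h1.not_nonempty_equiv h10 h2 fun heq => ?_,
    isComponentWithEigenvalue_lieSpan hx h h' h1 h10, ?_⟩
  · have := congrFun heq j.succ
    simp [lowerWeight, ← hij, e2.symm, e3.symm] at this
  · rw [hc]
    exact isComponentWithEigenvalue_lieSpan hx h h' h2 h20

end Singular

/-! ### Rank one: the scalar determines the component. -/

section RankOne

/-- The `E a a` sum to the traceless part of the identity, which is zero. -/
theorem IsHW.sum_eq_zero {M : Type*} [AddCommGroup M] [Module ℂ M] [LieRingModule (sl l) M]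
    [LieModule ℂ (sl l) M] {η : Fin (l + 1) → ℂ} {t : M} (ht : IsHW η t) (ht0 : t ≠ 0) :
    ∑ a, η a = 0 := by
  have h1 : ∑ a, (E a a : sl l) = 0 := by
    have h := traceless_eq_sum (1 : Matrix (Fin (l + 1)) (Fin (l + 1)) ℂ)
    have h0 : traceless l 1 = 0 := by
      have : ((l : ℂ) + 1) ≠ 0 := by exact_mod_cast l.succ_ne_zero
      ext1
      simp [this]
    simpa [h0, Matrix.one_apply] using h.symm
  have h2 : ∑ a, ⁅(E a a : sl l), t⁆ = 0 := by rw [← sum_lie, h1, zero_lie]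
  simp only [ht.diag, ← Finset.sum_smul] at h2
  exact (smul_eq_zero.1 h2).resolve_right ht0

theorem eq_of_isIrreducible {T : Type*} [AddCommGroup T] [Module ℂ T] [LieRingModule (sl l) T]
    [LieModule ℂ (sl l) T] {N₁ N₂ : LieSubmodule ℂ (sl l) T}
    (h₁ : LieModule.IsIrreducible ℂ (sl l) N₁) (h₂ : LieModule.IsIrreducible ℂ (sl l) N₂) {t : T}
    (ht : t ≠ 0) (ht₁ : t ∈ N₁) (ht₂ : t ∈ N₂) : N₁ = N₂ := by
  have key : ∀ N N' : LieSubmodule ℂ (sl l) T, LieModule.IsIrreducible ℂ (sl l) N → t ∈ N → t ∈ N' →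
      N ≤ N' := by
    intro N N' hN hm hm' y hy
    have : Nontrivial (N'.comap N.incl) :=
      ⟨⟨⟨t, hm⟩, LieSubmodule.mem_comap.2 hm'⟩, 0,
        fun h => ht (congrArg Subtype.val (congrArg Subtype.val h))⟩
    have h := LieSubmodule.eq_top_of_isIrreducible ℂ (sl l) N (N'.comap N.incl)
    have : (⟨y, hy⟩ : N) ∈ N'.comap N.incl := h ▸ LieSubmodule.mem_top _
    exact LieSubmodule.mem_comap.1 this
  exact le_antisymm (key _ _ h₁ ht₁ ht₂) (key _ _ h₂ ht₂ ht₁)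

theorem below_le_comap {M : Type*} [AddCommGroup M] [Module ℂ M] (f : Module.End ℂ M) (μ : ℂ) :
    below f μ ≤ (below f μ).comap f :=
  iSup_le fun r z hz => by
    have hz' := Module.End.mem_eigenspace_iff.1 hz
    rw [Submodule.mem_comap, hz']
    exact Submodule.smul_mem _ _ (mem_below r.2 hz')

/-- There is a functional of the same weight as `t`, normalized at `t`. -/
theorem IsHW.exists_dual {M : Type*} [AddCommGroup M] [Module ℂ M] [LieRingModule (sl l) M]
    [LieModule ℂ (sl l) M] {η : Fin (l + 1) → ℂ} {t : M} (ht : IsHW η t) (ht0 : t ≠ 0)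
    (hspan : ∀ m : M, m ∈ LieSubmodule.lieSpan ℂ (sl l) {t}) {s : Fin (l + 1) → ℂ}
    (hs : IsDecreasing s) :
    ∃ φ : Module.Dual ℂ M, φ t = 1 ∧ ∀ m, φ (diagEnd M s m) = (∑ a, s a * η a) * φ m := by
  set μ := ∑ a, s a * η a with hμ
  -- A functional vanishing on all lower weights but not at `t` has the weight of `t`.
  have hnot : t ∉ below (diagEnd M s) μ := fun h =>
    ht0 (Submodule.disjoint_def.1 (disjoint_below _ μ) _
      (Module.End.mem_eigenspace_iff.2 (ht.diagEnd_eq s)) h)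
  obtain ⟨φ, hφ, hle⟩ := Submodule.exists_le_ker_of_notMem hnot
  have hb : ∀ z ∈ below (diagEnd M s) μ, φ z = 0 := fun z hz => hle hz
  refine ⟨(φ t)⁻¹ • φ, by simp [hφ], fun m => ?_⟩
  obtain ⟨c, hc⟩ := ht.exists_of_mem_lieSpan hs (hspan m)
  have h1 := hb _ hc
  have h2 := hb _ (below_le_comap _ _ hc)
  rw [map_sub, map_smul, sub_eq_zero] at h1
  rw [map_sub, map_sub, map_smul, map_smul, ht.diagEnd_eq, map_smul, sub_eq_zero] at h2
  simp only [LinearMap.smul_apply, h1, h2, smul_eq_mul, ← hμ]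
  ring

variable {M : Type*} [AddCommGroup M] [Module ℂ M] [LieRingModule (sl 1) M] [LieModule ℂ (sl 1) M]
variable {M' : Type*} [AddCommGroup M'] [Module ℂ M'] [LieRingModule (sl 1) M']
  [LieModule ℂ (sl 1) M']

/-- The raising operator of `𝔰𝔩₂`. -/
abbrev raise (M : Type*) [AddCommGroup M] [Module ℂ M] [LieRingModule (sl 1) M]
    [LieModule ℂ (sl 1) M] : Module.End ℂ M := LieModule.toEnd ℂ (sl 1) M (E 0 1)

/-- The lowering operator of `𝔰𝔩₂`. -/
abbrev lower (M : Type*) [AddCommGroup M] [Module ℂ M] [LieRingModule (sl 1) M]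
    [LieModule ℂ (sl 1) M] : Module.End ℂ M := LieModule.toEnd ℂ (sl 1) M (E 1 0)

theorem eq_one_and_eq_zero_of_lt : ∀ {i j : Fin (1 + 1)}, j < i → i = 1 ∧ j = 0 := by decide

theorem Lowered.exists_pow {t y : M} (hy : Lowered (l := 1) t y) :
    ∃ i : ℕ, y = (lower M ^ i) t := by
  induction hy with
  | base => exact ⟨0, rfl⟩
  | step i j hij y hy ih =>
    obtain ⟨n, rfl⟩ := ih
    obtain ⟨rfl, rfl⟩ := eq_one_and_eq_zero_of_lt hij
    exact ⟨n + 1, by rw [pow_succ']; rfl⟩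

theorem IsHW.mem_span_pow {η : Fin 2 → ℂ} {t : M} (ht : IsHW (l := 1) η t)
    (hspan : ∀ m : M, m ∈ LieSubmodule.lieSpan ℂ (sl 1) {t}) (m : M) :
    m ∈ Submodule.span ℂ (Set.range fun i : ℕ => (lower M ^ i) t) := by
  refine Submodule.span_mono ?_ (ht.lieSpan_le (hspan m))
  intro z hz
  obtain ⟨i, rfl⟩ := Lowered.exists_pow hz
  exact ⟨i, rfl⟩

/-- The weight spaces of a highest weight module of `𝔰𝔩₂` are at most one-dimensional. -/
theorem IsHW.exists_smul_of_weight {η : Fin 2 → ℂ} {t : M} (ht : IsHW (l := 1) η t) (ht0 : t ≠ 0)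
    (hspan : ∀ m : M, m ∈ LieSubmodule.lieSpan ℂ (sl 1) {t}) {μ : ℂ} {x y : M}
    (hx : ⁅(E 0 0 - E 1 1 : sl 1), x⁆ = μ • x) (hy : ⁅(E 0 0 - E 1 1 : sl 1), y⁆ = μ • y)
    (hy0 : y ≠ 0) : ∃ c : ℂ, x = c • y := by
  have P := ht.hasPrimitiveVectorWith ht0 (a := 0) (b := 1) (by simp)
  set f := LieModule.toEnd ℂ (sl 1) M (E 0 0 - E 1 1) with hf
  have hdisj : Disjoint (f.eigenspace μ) (⨆ ν, ⨆ (_ : ν ≠ μ), f.eigenspace ν) :=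
    f.eigenspaces_iSupIndep μ
  have hpow : ∀ i : ℕ, (lower M ^ i) t ∈ f.eigenspace (η 0 - η 1 - 2 * i) := fun i =>
    Module.End.mem_eigenspace_iff.2 (P.lie_h_pow_toEnd_f i)
  -- The vectors `F^i t` have distinct weights. Here `u` is the one of weight `μ`, or `0` if there
  -- is none, and modulo the other eigenspaces every `F^i t` is a multiple of `u`.
  obtain ⟨u, hu, huspan⟩ : ∃ u ∈ f.eigenspace μ, ∀ i : ℕ, ∃ c : ℂ,
      (lower M ^ i) t - c • u ∈ ⨆ ν, ⨆ (_ : ν ≠ μ), f.eigenspace ν := by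
    by_cases h : ∃ i : ℕ, η 0 - η 1 - 2 * i = μ
    · obtain ⟨i, rfl⟩ := h
      refine ⟨_, hpow i, fun j => ?_⟩
      by_cases hij : j = i
      · exact ⟨1, by simp [hij]⟩
      · refine ⟨0, ?_⟩
        rw [zero_smul, sub_zero]
        refine Submodule.mem_iSup_of_mem _ (Submodule.mem_iSup_of_mem ?_ (hpow j))
        simpa using hij
    · push Not at h
      refine ⟨0, zero_mem _, fun j => ⟨0, ?_⟩⟩
      rw [zero_smul, sub_zero]
      exact Submodule.mem_iSup_of_mem _ (Submodule.mem_iSup_of_mem (h j) (hpow j))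
  have key : ∀ z ∈ f.eigenspace μ, ∃ c : ℂ, z = c • u := by
    intro z hz
    have hz' : z ∈ Submodule.span ℂ {u} ⊔ ⨆ ν, ⨆ (_ : ν ≠ μ), f.eigenspace ν := by
      refine Submodule.span_le.2 ?_ (ht.mem_span_pow hspan z)
      rintro _ ⟨i, rfl⟩
      obtain ⟨c, hc⟩ := huspan i
      exact Submodule.mem_sup.2 ⟨c • u, Submodule.smul_mem _ _ (Submodule.mem_span_singleton_self u),
        _, hc, add_sub_cancel _ _⟩
    obtain ⟨a, ha, b, hb, hab⟩ := Submodule.mem_sup.1 hz'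
    obtain ⟨c, rfl⟩ := Submodule.mem_span_singleton.1 ha
    refine ⟨c, ?_⟩
    have hb' : b ∈ f.eigenspace μ := by
      rw [← add_sub_cancel_left (c • u) b, hab]
      exact sub_mem hz (Submodule.smul_mem _ _ hu)
    rw [← hab, Submodule.disjoint_def.1 hdisj b hb' hb, add_zero]
  obtain ⟨c, rfl⟩ := key x (Module.End.mem_eigenspace_iff.2 hx)
  obtain ⟨d, rfl⟩ := key y (Module.End.mem_eigenspace_iff.2 hy)
  have hd : d ≠ 0 := fun h => hy0 (by rw [h, zero_smul])
  exact ⟨c / d, by rw [smul_smul, div_mul_cancel₀ _ hd]⟩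

theorem IsHW.raise_pow_lower_pow_of_lt {η : Fin 2 → ℂ} {t : M} (ht : IsHW (l := 1) η t)
    (ht0 : t ≠ 0) {i n : ℕ} (hin : i < n) : (raise M ^ n) ((lower M ^ i) t) = 0 := by
  have P := ht.hasPrimitiveVectorWith ht0 (a := 0) (b := 1) (by simp)
  induction n generalizing i with
  | zero => omega
  | succ n ih =>
    rw [pow_succ, Module.End.mul_apply]
    cases i with
    | zero =>
      have : raise M t = 0 := P.lie_e
      simp [this]
    | succ i =>
      have h : raise M ((lower M ^ (i + 1)) t) = _ := P.lie_e_pow_succ_toEnd_f i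
      rw [h, map_smul, ih (by omega), smul_zero]

/-- Passing from `n` to `n + 1` multiplies the constant by `(n+1)(k-n)`, which is nonzero as long as
`n < k`. -/
theorem IsHW.raise_pow_lower_pow {η : Fin 2 → ℂ} {t : M} (ht : IsHW (l := 1) η t)
    (ht0 : t ≠ 0) {k n : ℕ} (hk : η 0 - η 1 = k) (hn : n ≤ k) :
    ∃ c : ℂ, c ≠ 0 ∧ (raise M ^ n) ((lower M ^ n) t) = c • t := by
  have P := ht.hasPrimitiveVectorWith ht0 (a := 0) (b := 1) (by simp)
  induction n with
  | zero => exact ⟨1, one_ne_zero, by simp⟩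
  | succ n ih =>
    obtain ⟨c, hc, h⟩ := ih (by omega)
    have h1 : raise M ((lower M ^ (n + 1)) t) = _ := P.lie_e_pow_succ_toEnd_f n
    refine ⟨(n + 1) * (k - n) * c, ?_, ?_⟩
    · refine mul_ne_zero (mul_ne_zero (by exact_mod_cast n.succ_ne_zero) ?_) hc
      rw [sub_ne_zero]
      exact_mod_cast (by omega : k ≠ n)
    · rw [pow_succ, Module.End.mul_apply, h1, map_smul, h, smul_smul, hk]

/-- Contraction of the first tensor factor with a functional. -/
def contract (φ : Module.Dual ℂ M) (M' : Type*) [AddCommGroup M'] [Module ℂ M'] :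
    M ⊗[ℂ] M' →ₗ[ℂ] M' :=
  (TensorProduct.lid ℂ M').toLinearMap ∘ₗ φ.rTensor M'

@[simp]
theorem contract_tmul (φ : Module.Dual ℂ M) (m : M) (m' : M') :
    contract φ M' (m ⊗ₜ m') = φ m • m' := by
  simp [contract]

/-- On a singular vector `E ⊗ 1` acts as `-(1 ⊗ E)`, and `1 ⊗ E` commutes both with `E ⊗ 1` and with
contraction of the first factor. -/
theorem contract_raise_pow (φ : Module.Dual ℂ M) {y : M ⊗[ℂ] M'} (hy : ⁅(E 0 1 : sl 1), y⁆ = 0)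
    (h0 : contract φ M' y = 0) (n : ℕ) :
    contract φ M' (((raise M).rTensor M' ^ n) y) = 0 := by
  have hA : (raise M).rTensor M' y = -(raise M').lTensor M y := eq_neg_of_add_eq_zero_left hy
  have hcomm : Commute ((raise M').lTensor M) ((raise M).rTensor M') :=
    TensorProduct.ext' fun m m' => by simp
  have hB : ∀ z, contract φ M' ((raise M').lTensor M z) = raise M' (contract φ M' z) := by
    intro z
    have : contract φ M' ∘ₗ (raise M').lTensor M = raise M' ∘ₗ contract φ M' :=
      TensorProduct.ext' fun m m' => by simp
    exact LinearMap.congr_fun this z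
  induction n with
  | zero => simpa using h0
  | succ n ih =>
    rw [pow_succ, Module.End.mul_apply, hA, map_neg, ← Module.End.mul_apply,
      ← (hcomm.pow_right n).eq, Module.End.mul_apply, map_neg, hB, ih, map_zero, neg_zero]

/-- A singular vector in a tensor product is determined by its contraction with a functional that
does not vanish on the highest weight vector of the first factor. -/
theorem IsHW.eq_zero_of_contract_eq_zero [FiniteDimensional ℂ M] {η : Fin 2 → ℂ} {t : M}
    (ht : IsHW (l := 1) η t) (ht0 : t ≠ 0)
    (hspan : ∀ m : M, m ∈ LieSubmodule.lieSpan ℂ (sl 1) {t}) {φ : Module.Dual ℂ M} (hφ : φ t = 1)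
    {y : M ⊗[ℂ] M'} (hy : ⁅(E 0 1 : sl 1), y⁆ = 0) (h0 : contract φ M' y = 0) : y = 0 := by
  obtain ⟨k, hk⟩ := ht.exists_nat ht0 (a := 0) (b := 1) (by simp)
  have hlow : ∀ i, k < i → (lower M ^ i) t = 0 := by
    intro i hi
    have h := (ht.hasPrimitiveVectorWith ht0 (a := 0) (b := 1)
      (by simp)).pow_toEnd_f_eq_zero_of_eq_nat hk
    rw [← Nat.sub_add_cancel (show k + 1 ≤ i from hi), pow_add, Module.End.mul_apply]
    exact (congrArg _ h).trans (map_zero _)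
  have hex : ∀ y : M ⊗[ℂ] M', ∃ g : ℕ → M', y = ∑ i ∈ Finset.range (k + 1), (lower M ^ i) t ⊗ₜ g i := by
    intro y
    induction y using TensorProduct.induction_on with
    | zero => exact ⟨0, by simp⟩
    | add y z hy hz =>
      obtain ⟨g, rfl⟩ := hy
      obtain ⟨g', rfl⟩ := hz
      exact ⟨g + g', by simp [TensorProduct.tmul_add, Finset.sum_add_distrib]⟩
    | tmul m m' =>
      have hm := ht.mem_span_pow hspan m
      induction hm using Submodule.span_induction with
      | mem z hz =>
        obtain ⟨i, rfl⟩ := hz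
        by_cases hi : k < i
        · exact ⟨0, by simp [hlow i hi]⟩
        · refine ⟨Pi.single i m', ?_⟩
          rw [Finset.sum_eq_single i]
          · simp
          · intro j _ hj; simp [hj]
          · intro h; exact absurd (Finset.mem_range.2 (by omega)) h
      | zero => exact ⟨0, by simp⟩
      | add x z _ _ hx hz =>
        obtain ⟨g, hg⟩ := hx
        obtain ⟨g', hg'⟩ := hz
        exact ⟨g + g', by
          simp [TensorProduct.add_tmul, hg, hg', TensorProduct.tmul_add, Finset.sum_add_distrib]⟩
      | smul a x _ hx =>
        obtain ⟨g, hg⟩ := hx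
        exact ⟨a • g, by
          simp [← TensorProduct.smul_tmul', hg, TensorProduct.tmul_smul, Finset.smul_sum]⟩
  obtain ⟨g, hg⟩ := hex y
  -- The terms are removed from the top: `E^n ⊗ 1` kills those with `i < n` and turns the last into
  -- a nonzero multiple of `t ⊗ g n`, so contraction forces `g n = 0`.
  have hdesc : ∀ n ≤ k + 1, y = ∑ i ∈ Finset.range n, (lower M ^ i) t ⊗ₜ g i → y = 0 := by
    intro n
    induction n with
    | zero => intro _ h; simpa using h
    | succ n ih =>
      intro hn h
      refine ih (by omega) ?_
      obtain ⟨c, hc, hcn⟩ := ht.raise_pow_lower_pow ht0 hk (n := n) (by omega)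
      have h1 := contract_raise_pow φ hy h0 n
      have hr : (raise M).rTensor M' ^ n = ((raise M) ^ n).rTensor M' :=
        (raise M).rTensor_pow n
      rw [hr, h, map_sum, map_sum, Finset.sum_eq_single n] at h1
      · rw [LinearMap.rTensor_tmul, hcn, contract_tmul, map_smul, hφ, smul_eq_mul, mul_one] at h1
        rw [h, Finset.sum_range_succ, (smul_eq_zero.1 h1).resolve_left hc, TensorProduct.tmul_zero,
          add_zero]
      · intro i hi hin
        have : i < n := by have := Finset.mem_range.1 hi; omega
        rw [LinearMap.rTensor_tmul, ht.raise_pow_lower_pow_of_lt ht0 this, TensorProduct.zero_tmul,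
          map_zero]
      · intro h; simp at h
  exact hdesc (k + 1) le_rfl hg

/-- Singular vectors of a given weight in a tensor product of highest weight modules of `𝔰𝔩₂` are
proportional. -/
theorem IsHW.exists_smul_of_tensor [FiniteDimensional ℂ M] {η θ ζ : Fin 2 → ℂ} {t : M} {t' : M'}
    (ht : IsHW (l := 1) η t) (ht0 : t ≠ 0)
    (hspan : ∀ m : M, m ∈ LieSubmodule.lieSpan ℂ (sl 1) {t})
    (ht' : IsHW (l := 1) θ t') (ht0' : t' ≠ 0)
    (hspan' : ∀ m : M', m ∈ LieSubmodule.lieSpan ℂ (sl 1) {t'})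
    {y z : M ⊗[ℂ] M'} (hy : IsHW (l := 1) ζ y) (hz : IsHW (l := 1) ζ z) (hz0 : z ≠ 0) :
    ∃ c : ℂ, y = c • z := by
  -- With these coefficients `diagEnd` is the action of the coroot `E 0 0 - E 1 1`.
  set s : Fin (1 + 1) → ℂ := fun a => if a = 0 then 1 else -1 with hs_def
  have hs : IsDecreasing s := by
    intro a b hab
    obtain ⟨rfl, rfl⟩ := eq_one_and_eq_zero_of_lt hab
    exact ⟨2, by norm_num, by simp [hs_def]; norm_num⟩
  have hdiag : ∀ (N : Type _) [AddCommGroup N] [Module ℂ N] [LieRingModule (sl 1) N]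
      [LieModule ℂ (sl 1) N] (m : N), ⁅(E 0 0 - E 1 1 : sl 1), m⁆ = diagEnd N s m := by
    intro N _ _ _ _ m
    rw [diagEnd_apply, Fin.sum_univ_two, sub_lie]
    simp [hs_def, sub_eq_add_neg]
  obtain ⟨φ, hφ, hφ'⟩ := ht.exists_dual ht0 hspan hs
  -- Contraction subtracts the weight of `φ`, so the contractions of `y` and `z` lie in the same
  -- weight space of `M'`, which is at most a line.
  have hw : ∀ y : M ⊗[ℂ] M', IsHW (l := 1) ζ y → ⁅(E 0 0 - E 1 1 : sl 1), contract φ M' y⁆ =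
      (∑ a, s a * ζ a - ∑ a, s a * η a) • contract φ M' y := by
    intro y hy
    have h1 : ∀ y : M ⊗[ℂ] M', contract φ M' ⁅(E 0 0 - E 1 1 : sl 1), y⁆ =
        (∑ a, s a * η a) • contract φ M' y + ⁅(E 0 0 - E 1 1 : sl 1), contract φ M' y⁆ := by
      intro y
      induction y using TensorProduct.induction_on with
      | zero => simp
      | add y z hy hz =>
        rw [lie_add, map_add, hy, hz, map_add, lie_add, smul_add]
        abel
      | tmul m m' =>
        rw [TensorProduct.LieModule.lie_tmul_right, map_add, contract_tmul, contract_tmul,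
          contract_tmul, hdiag M, hφ', lie_smul, mul_smul]
    have h2 : ⁅(E 0 0 - E 1 1 : sl 1), y⁆ = (∑ a, s a * ζ a) • y := by
      rw [← hy.diagEnd_eq s, diagEnd_apply, Fin.sum_univ_two, sub_lie]
      simp [hs_def, sub_eq_add_neg]
    have h3 := h1 y
    rw [h2, map_smul] at h3
    rw [sub_smul, h3, add_sub_cancel_left]
  have e01 : (0 : Fin 2) < 1 := by simp
  have hz1 : contract φ M' z ≠ 0 := fun h =>
    hz0 (ht.eq_zero_of_contract_eq_zero ht0 hspan hφ (hz.upper 0 1 e01) h)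
  obtain ⟨c, hc⟩ := ht'.exists_smul_of_weight ht0' hspan' (hw y hy) (hw z hz) hz1
  refine ⟨c, sub_eq_zero.1 (ht.eq_zero_of_contract_eq_zero ht0 hspan hφ ?_ ?_)⟩
  · rw [lie_sub, lie_smul, hy.upper 0 1 e01, hz.upper 0 1 e01, smul_zero, sub_zero]
  · rw [map_sub, map_smul, hc, sub_self]

theorem isFiniteWeight_of_rank_one (a : Fin 1 → ℕ) : IsFiniteWeight (dominantWeight 1 a) :=
  isFiniteWeight_dominantWeight fun i hi => by omega

/-- In rank one, the eigenvalue of a component determines the component. -/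
theorem eq_of_isComponentWithEigenvalue {ι : Type*} [Fintype ι] [DecidableEq ι]
    {x : Module.Basis ι ℂ (sl 1)} {xs : ι → sl 1} (hx : IsKillingDual x xs) {a b : Fin 1 → ℕ}
    {N₁ N₂ : LieSubmodule ℂ (sl 1) (V 1 (dominantWeight 1 a) ⊗[ℂ] V 1 (dominantWeight 1 b))} {c : ℂ}
    (h₁ : IsComponentWithEigenvalue (casimirM x xs _ _) N₁ c)
    (h₂ : IsComponentWithEigenvalue (casimirM x xs _ _) N₂ c) : N₁ = N₂ := by
  have h := isFiniteWeight_of_rank_one a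
  have h' := isFiniteWeight_of_rank_one b
  have := h.finiteDimensional
  have := h'.finiteDimensional
  have hne : ∀ N : LieSubmodule ℂ (sl 1) (V 1 (dominantWeight 1 a) ⊗[ℂ] V 1 (dominantWeight 1 b)),
      LieModule.IsIrreducible ℂ (sl 1) N → N ≠ ⊥ := fun N hN =>
    (LieSubmodule.nontrivial_iff_ne_bot ℂ (sl 1) _).1
      (LieModule.nontrivial_of_isIrreducible ℂ (sl 1) N)
  obtain ⟨η, y, hyN, hy0, hy⟩ := exists_isHW_mem (hne _ h₁.1)
  obtain ⟨ζ, z, hzN, hz0, hz⟩ := exists_isHW_mem (hne _ h₂.1)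
  have hcy := casimir_tensor_V hx h h' y
  have hcz := casimir_tensor_V hx h h' z
  rw [hy.casimir_eq, h₁.2 y hyN, smul_smul, ← add_smul] at hcy
  rw [hz.casimir_eq, h₂.2 z hzN, smul_smul, ← add_smul] at hcz
  have hc : casimirScalar η = casimirScalar ζ :=
    (smul_left_injective ℂ hy0 hcy).trans (smul_left_injective ℂ hz0 hcz).symm
  have sη := hy.sum_eq_zero hy0
  have sζ := hz.sum_eq_zero hz0
  obtain ⟨n, hn⟩ := hy.exists_nat hy0 (a := 0) (b := 1) (by simp)
  obtain ⟨m, hm⟩ := hz.exists_nat hz0 (a := 0) (b := 1) (by simp)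
  rw [casimirScalar, casimirScalar, Fin.sum_univ_two, Fin.sum_univ_two] at hc
  rw [Fin.sum_univ_two] at sη sζ
  -- The Casimir scalars are `n(n+2)/2` and `m(m+2)/2`, and `n(n+2) - m(m+2) = (n-m)(n+m+2)`.
  have hfac : ((n : ℂ) - m) * (n + m + 2) = 0 := by
    have e1 : η 1 = -η 0 := by linear_combination sη
    have e2 : ζ 1 = -ζ 0 := by linear_combination sζ
    rw [e1, e2] at hc
    rw [e1] at hn
    rw [e2] at hm
    simp at hc
    rw [← hn, ← hm]
    linear_combination 2 * hc
  have hnm : (n : ℂ) = m := by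
    refine sub_eq_zero.1 ((mul_eq_zero.1 hfac).resolve_right ?_)
    exact_mod_cast (by omega : n + m + 2 ≠ 0)
  have hηζ : η = ζ := by
    have e0 : η 0 = ζ 0 := by linear_combination (sη - sζ + hn - hm + hnm) / 2
    funext i
    fin_cases i
    · exact e0
    · change η 1 = ζ 1
      linear_combination sη - sζ - e0
  subst hηζ
  -- The two singular vectors are proportional, so the irreducible submodules share a nonzero
  -- vector.
  obtain ⟨d, hd⟩ := h.isHW_hwVec.exists_smul_of_tensor h.hwVec_ne_zero mem_lieSpan_hwVec
    h'.isHW_hwVec h'.hwVec_ne_zero mem_lieSpan_hwVec hy hz hz0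
  exact eq_of_isIrreducible h₁.1 h₂.1 hy0 hyN (hd ▸ N₂.smul_mem d hzN)

end RankOne

end TypeA

end

theorem proposition5p3 (l k : ℕ) (hl : 1 ≤ l) (hk : 2 ≤ k)
    {ι : Type*} [Fintype ι] [DecidableEq ι]
    (x : Module.Basis ι ℂ (TypeA.sl l)) (xs : ι → TypeA.sl l) (hx : TypeA.IsKillingDual x xs) :
    ((∃ (a : Fin l → ℕ)
        (N₁ N₂ : LieSubmodule ℂ (TypeA.sl l)
          (TypeA.V l (TypeA.dominantWeight l (TypeA.kOmegaOne l k)) ⊗[ℂ]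
            TypeA.V l (TypeA.dominantWeight l a))) (c : ℂ),
        N₁ ≠ N₂ ∧
        TypeA.IsComponentWithEigenvalue (TypeA.casimirM x xs _ _) N₁ c ∧
        TypeA.IsComponentWithEigenvalue (TypeA.casimirM x xs _ _) N₂ c) ↔ 2 ≤ l) ∧
    ((∃ (a : Fin l → ℕ)
        (N₁ N₂ : LieSubmodule ℂ (TypeA.sl l)
          (TypeA.V l (TypeA.dominantWeight l (TypeA.kOmegaOne l k)) ⊗[ℂ]
            TypeA.V l (TypeA.dominantWeight l a))) (c : ℂ),
        ¬ Nonempty (N₁ ≃ₗ⁅ℂ, TypeA.sl l⁆ N₂) ∧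
        TypeA.IsComponentWithEigenvalue (TypeA.casimirM x xs _ _) N₁ c ∧
        TypeA.IsComponentWithEigenvalue (TypeA.casimirM x xs _ _) N₂ c) ↔ 2 ≤ l) := by
  refine ⟨⟨?_, fun h => ?_⟩, ⟨?_, fun h => TypeA.exists_components h hk hx⟩⟩
  · rintro ⟨a, N₁, N₂, c, hne, h₁, h₂⟩
    by_contra hl2
    obtain rfl : l = 1 := by omega
    exact hne (TypeA.eq_of_isComponentWithEigenvalue hx h₁ h₂)
  · obtain ⟨a, N₁, N₂, c, hne, h₁, h₂⟩ := TypeA.exists_components h hk hx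
    refine ⟨a, N₁, N₂, c, ?_, h₁, h₂⟩
    rintro rfl
    exact hne ⟨LieModuleEquiv.refl⟩
  · rintro ⟨a, N₁, N₂, c, hne, h₁, h₂⟩
    by_contra hl2
    obtain rfl : l = 1 := by omega
    obtain rfl := TypeA.eq_of_isComponentWithEigenvalue hx h₁ h₂
    exact hne ⟨LieModuleEquiv.refl⟩
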